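/- **Setting.** Consider the discrete-time LTI plant $$x_{k+1}=Ax_k+B_1w_k+Bu_k,\qquad z_k=C_1x_k+D_1w_k+Eu_k,\qquad y_k=Cx_k+Fw_k,$$ with $x_k\in\mathbb R^n$, $w_k\in\mathbb R^p$, $u_k\in\mathbb R^m$, $z_k\in\mathbb R^q$, $y_k\in\mathbb R^l$. The matrices $B_1,C_1,D_1,E,C,F$ are known, while $A,B$ are unknown. States $x_0,\dots,x_N$ and inputs $u_0,\dots,u_{N-1}$ are recorded; put $X_+=(x_1\cdots x_N)$, $X_-=(x_0\cdots x_{N-1})$, $U_-=(u_0\cdots u_{N-1})$. Let $$\Phi=\begin{pmatrix}B_1\Phi_{11}B_1^\top & B_1\Phi_{12}\\ \Phi_{12}^\top B_1^\top&\Phi_{22}\end{pmatrix}=\Phi^\top\in\mathbb R^{(n+N)\times(n+N)},\qquad \Phi_{22}\prec0,$$ be a given matrix. Let $\Sigma$ be the set of all $(A,B)$ such that $X_+=AX_-+BU_-+B_1W$ for some $W\in\mathbb R^{p\times N}$ with $$\begin{pmatrix}I& B_1W\end{pmatrix}\Phi\begin{pmatrix}I& B_1W\end{pmatrix}^\top\succeq0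 .$$ Assume that $\operatorname{rank}\begin{pmatrix}X_-\\U_-\end{pmatrix}=n+m$ and that $\Sigma\neq\emptyset$, and fix any $(A_s,B_s)\in\Sigma$. Let $Q=Q^\top\in\mathbb R^{p\times p}$, $S\in\mathbb R^{p\times q}$ and $0\preceq R=R^\top\in\mathbb R^{q\times q}$ be given. Put $$\tilde\Phi=\begin{pmatrix}\tilde\Phi_{11}&\tilde\Phi_{12}&\tilde\Phi_{13}\\ \tilde\Phi_{12}^\top&\tilde\Phi_{22}&\tilde\Phi_{23}\\ \tilde\Phi_{13}^\top&\tilde\Phi_{23}^\top&\tilde\Phi_{33}\end{pmatrix}=L^\top\Phi L,\qquad L=\begin{pmatrix}I&0&0\\X_+^\top&-X_-^\top&-U_-^\top\end{pmatrix},$$ partitioned with block sizes $n,n,m$. Let $$\begin{pmatrix}I&A_s&B_s\end{pmatrix}\tilde\Phi\begin{pmatrix}I&A_s&B_s\end{pmatrix}^\top=\Xi\Lambda\Xi^\top,\qquad R=T\tilde RT^\top$$ be arbitrary factorizations with positive definite $\Lambda\in\mathbb R^{\tilde n\times\tilde n}$ and $\tilde R\in\mathbb R^{\tilde q\times\tilde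 q}$. A full-order controller $x_{c,k+1}=A_cx_{c,k}+B_cy_k$, $u_k=C_cx_{c,k}+D_cy_k$ (with $x_{c,k}\in\mathbb R^n$) gives the closed loop with state $(x_k,x_{c,k})$, input $w_k$, output $z_k$ and matrices $$\tilde A=\begin{pmatrix}A+BD_cC&BC_c\\B_cC&A_c\end{pmatrix},\quad \tilde B=\begin{pmatrix}B_1+BD_cF\\B_cF\end{pmatrix},\quad \tilde C=\begin{pmatrix}C_1+ED_cC&EC_c\end{pmatrix},\quad \tilde D=D_1+ED_cF .$$ It is called *robustly strictly dissipative* if there is one symmetric matrix $P\succ0$ such that for all $(A,B)\in\Sigma$ $$\begin{pmatrix}I&0\\ \tilde A&\tilde B\\0&I\\ \tilde C&\tilde D\end{pmatrix}^{\!\top}\begin{pmatrix}-P&0&0&0\\0&P&0&0\\0&0&Q&S\\0&0&S^\top&R\end{pmatrix}\begin{pmatrix}I&0\\ \tilde A&\tilde B\\0&I\\ \tilde C&\tilde D\end{pmatrix}\prec0 .$$ **The matrix $\Pi$.** For a scalar $\alpha$, symmetric $X,Y\in\mathbb R^{n\times n}$, and matrices $\tilde A_c\in\mathbb R^{n\times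 n}$, $\tilde B_c\in\mathbb R^{n\times l}$, $\tilde C_c\in\mathbb R^{m\times n}$, $D_c\in\mathbb R^{m\times l}$ write $G_1=C_1+ED_cC$, $G_2=C_1Y+E\tilde C_c$, $G_3=D_1+ED_cF$, $H_2=\tilde\Phi_{12}+A_s\tilde\Phi_{22}+B_s\tilde\Phi_{23}^\top$, $H_3=\tilde\Phi_{13}+A_s\tilde\Phi_{23}+B_s\tilde\Phi_{33}$, and let $\Pi=\begin{pmatrix}\Pi_{11}&\Pi_{12}\\ \Pi_{12}^\top&\Pi_{22}\end{pmatrix}$ with ($\star$ denoting blocks determined by symmetry) $$\Pi_{11}=\begin{pmatrix}X&I&\star&\star\\I&Y&\star&\star\\-SG_1&-SG_2&-Q-(SG_3)^\top-SG_3&\star\\T^\top G_1&T^\top G_2&T^\top G_3&\tilde R^{-1}\end{pmatrix},$$ $$\Pi_{12}^\top=\begin{pmatrix}A_s+B_sD_cC&A_sY+B_s\tilde C_c&B_1+B_sD_cF&0\\XA_s+\tilde B_cC&\tilde A_c&XB_1+\tilde B_cF&0\\I&Y&0&0\\D_cC&\tilde C_c&D_cF&0\\0&0&0&0\end{pmatrix},$$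 $$\Pi_{22}=\begin{pmatrix}Y&I&-\alpha H_2&-\alpha H_3&\alpha\Xi\\I&X&-\alpha XH_2&-\alpha XH_3&\alpha X\Xi\\ \star&\star&-\alpha\tilde\Phi_{22}&-\alpha\tilde\Phi_{23}&0\\ \star&\star&\star&-\alpha\tilde\Phi_{33}&0\\ \star&\star&\star&\star&\alpha\Lambda^{-1}\end{pmatrix}.$$ **Theorem.** There is a full-order controller that is robustly strictly dissipative if and only if $\Pi\succ0$ for some real $\alpha$, symmetric $X,Y$ and matrices $\tilde A_c,\tilde B_c,\tilde C_c,D_c$. Furthermore, if $\alpha,X,Y,\tilde A_c,\tilde B_c,\tilde C_c,D_c$ (with $X,Y$ symmetric) satisfy $\Pi\succ0$ and $U\in\mathbb R^{n\times n}$ is an arbitrary full-rank matrix, then the matrix $V$ defined by $V^\top=U^{-1}(I-XY)$ is invertible, and the controller given by $D_c$ and $$B_c=U^{-1}(\tilde B_c-XB_sD_c),\qquad C_c=(\tilde C_c-D_cCY)V^{-\top},$$ $$A_c=U^{-1}\bigl(\tilde A_c-X(A_sY+B_s\tilde C_c)-UB_cCY\bigr)V^{-\top}$$ is robustly strictly dissipative.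 -/

import Mathlib

open Matrix

namespace DataDissipativity

/-- Blocks side by side. -/
infixr:62 " ◨ " => Matrix.fromCols

/-- Blocks on top of each other. -/
infixr:61 " ⬓ " => Matrix.fromRows

/-- The known matrices of the plant
`x⁺ = A x + B₁ w + B u`, `z = C₁ x + D₁ w + E u`, `y = C x + F w`,
with `x ∈ ℝⁿ`, `u ∈ ℝᵐ`, `w ∈ ℝᵖ`, `z ∈ ℝ^q`, `y ∈ ℝˡ`. The matrices `A`, `B` are unknown. -/
structure KnownModel (n m p q l : ℕ) where
  B₁ : Matrix (Fin n) (Fin p) ℝ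
  C₁ : Matrix (Fin q) (Fin n) ℝ
  D₁ : Matrix (Fin q) (Fin p) ℝ
  E : Matrix (Fin q) (Fin m) ℝ
  C : Matrix (Fin l) (Fin n) ℝ
  F : Matrix (Fin l) (Fin p) ℝ

/-- The matrices of a full-order controller `x_c⁺ = Ac x_c + Bc y`, `u = Cc x_c + Dc y`. -/
structure Controller (n m l : ℕ) where
  Ac : Matrix (Fin n) (Fin n) ℝ
  Bc : Matrix (Fin n) (Fin l) ℝ
  Cc : Matrix (Fin m) (Fin n) ℝ
  Dc : Matrix (Fin m) (Fin l) ℝ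

/-- The coefficients of the supply function `s(w, z) = (w, z)ᵀ (-Q, -S; -Sᵀ, -R) (w, z)`. -/
structure Supply (p q : ℕ) where
  Q : Matrix (Fin p) (Fin p) ℝ
  S : Matrix (Fin p) (Fin q) ℝ
  R : Matrix (Fin q) (Fin q) ℝ

/-- The recorded states `x₀, …, x_N` and inputs `u₀, …, u_{N-1}`. -/
structure Recording (n m N : ℕ) where
  x : Fin (N + 1) → Fin n → ℝ
  u : Fin N → Fin m → ℝ

/-- The coefficients of the quadratic bound on the disturbance during the recording. -/
structure NoiseBound (p N : ℕ) where
  Φ₁₁ : Matrix (Fin p) (Fin p) ℝ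
  Φ₁₂ : Matrix (Fin p) (Fin N) ℝ
  Φ₂₂ : Matrix (Fin N) (Fin N) ℝ

/-- The decision variables `α, X, Y, Ã_c, B̃_c, C̃_c, D_c`; `X` and `Y` are meant to be symmetric,
which is required separately. -/
structure Decision (n m l : ℕ) where
  α : ℝ
  X : Matrix (Fin n) (Fin n) ℝ
  Y : Matrix (Fin n) (Fin n) ℝ
  At : Matrix (Fin n) (Fin n) ℝ
  Bt : Matrix (Fin n) (Fin l) ℝ
  Ct : Matrix (Fin m) (Fin n) ℝ
  Dc : Matrix (Fin m) (Fin l) ℝ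

/-- The left-hand side of the dissipation inequality of `x⁺ = A x + B w`, `z = C x + D w`. -/
def dissipationMatrix {ι : Type*} [Fintype ι] [DecidableEq ι] {p q : ℕ} (s : Supply p q)
    (P A : Matrix ι ι ℝ) (B : Matrix ι (Fin p) ℝ) (C : Matrix (Fin q) ι ℝ)
    (D : Matrix (Fin q) (Fin p) ℝ) : Matrix (ι ⊕ Fin p) (ι ⊕ Fin p) ℝ :=
  let J : Matrix ((ι ⊕ ι) ⊕ (Fin p ⊕ Fin q)) (ι ⊕ Fin p) ℝ :=
    (1 ◨ 0 ⬓ A ◨ B) ⬓ (0 ◨ 1 ⬓ C ◨ D)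
  Jᵀ * fromBlocks (fromBlocks (-P) 0 0 P) 0 0 (fromBlocks s.Q s.S s.Sᵀ s.R) * J

/-- Strict dissipativity of `x⁺ = A x + B w`, `z = C x + D w` with storage function `xᵀ P x`. -/
def StrictlyDissipative {ι : Type*} [Fintype ι] [DecidableEq ι] {p q : ℕ} (s : Supply p q)
    (P A : Matrix ι ι ℝ) (B : Matrix ι (Fin p) ℝ) (C : Matrix (Fin q) ι ℝ)
    (D : Matrix (Fin q) (Fin p) ℝ) : Prop :=
  (-dissipationMatrix s P A B C D).PosDef

section ClosedLoop

variable {n m p q l : ℕ} (M : KnownModel n m p q l) (K : Controller n m l)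
  (A : Matrix (Fin n) (Fin n) ℝ) (B : Matrix (Fin n) (Fin m) ℝ)

/-- State matrix of the closed loop, whose state is `(x, x_c)`. -/
def clA : Matrix (Fin n ⊕ Fin n) (Fin n ⊕ Fin n) ℝ :=
  fromBlocks (A + B * K.Dc * M.C) (B * K.Cc) (K.Bc * M.C) K.Ac

def clB : Matrix (Fin n ⊕ Fin n) (Fin p) ℝ :=
  (M.B₁ + B * K.Dc * M.F) ⬓ (K.Bc * M.F)

def clC : Matrix (Fin q) (Fin n ⊕ Fin n) ℝ :=
  (M.C₁ + M.E * K.Dc * M.C) ◨ (M.E * K.Cc)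

def clD : Matrix (Fin q) (Fin p) ℝ :=
  M.D₁ + M.E * K.Dc * M.F

end ClosedLoop

section Data

variable {n m p q l N : ℕ} (M : KnownModel n m p q l) (r : Recording n m N) (b : NoiseBound p N)

/-- `X₊ = (x₁ … x_N)`. -/
def Recording.Xplus : Matrix (Fin n) (Fin N) ℝ := Matrix.of fun i k => r.x k.succ i

/-- `X₋ = (x₀ … x_{N-1})`. -/
def Recording.Xminus : Matrix (Fin n) (Fin N) ℝ := Matrix.of fun i k => r.x k.castSucc i

/-- `U₋ = (u₀ … u_{N-1})`. -/
def Recording.Uminus : Matrix (Fin m) (Fin N) ℝ := Matrix.of fun i k => r.u k i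

/-- The matrix `Φ` of the disturbance bound. -/
def noiseMatrix : Matrix (Fin n ⊕ Fin N) (Fin n ⊕ Fin N) ℝ :=
  fromBlocks (M.B₁ * b.Φ₁₁ * M.B₁ᵀ) (M.B₁ * b.Φ₁₂) (b.Φ₁₂ᵀ * M.B₁ᵀ) b.Φ₂₂

/-- The disturbance matrix `W = (w₀ … w_{N-1})` obeys the bound. -/
def NoiseAdmissible (W : Matrix (Fin p) (Fin N) ℝ) : Prop :=
  (((1 : Matrix (Fin n) (Fin n) ℝ) ⬓ Wᵀ * M.B₁ᵀ)ᵀ * noiseMatrix M b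
    * ((1 : Matrix (Fin n) (Fin n) ℝ) ⬓ Wᵀ * M.B₁ᵀ)).PosSemidef

/-- The set `Σ` of all `(A, B)` that explain the recorded data with an admissible disturbance. -/
def consistentSystems : Set (Matrix (Fin n) (Fin n) ℝ × Matrix (Fin n) (Fin m) ℝ) :=
  {AB | ∃ W : Matrix (Fin p) (Fin N) ℝ, NoiseAdmissible M b W ∧
    r.Xplus = AB.1 * r.Xminus + AB.2 * r.Uminus + M.B₁ * W}

/-- The controller `K` makes the closed loop strictly dissipative for all systems in `Σ`, with one
storage function `ξᵀ P ξ`, `P ≻ 0`. -/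
def RobustlyDissipative (s : Supply p q) (K : Controller n m l) : Prop :=
  ∃ P : Matrix (Fin n ⊕ Fin n) (Fin n ⊕ Fin n) ℝ, P.PosDef ∧
    ∀ A B, (A, B) ∈ consistentSystems M r b →
      StrictlyDissipative s P (clA M K A B) (clB M K B) (clC M K) (clD M K)

/-- The matrix `(I, 0, 0; X₊ᵀ, -X₋ᵀ, -U₋ᵀ)`. -/
def dataMatrix : Matrix (Fin n ⊕ Fin N) (Fin n ⊕ Fin n ⊕ Fin m) ℝ :=
  (1 ◨ 0 ◨ 0) ⬓ (r.Xplusᵀ ◨ -r.Xminusᵀ ◨ -r.Uminusᵀ)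

/-- The matrix `Φ̃`. -/
def PhiT : Matrix (Fin n ⊕ Fin n ⊕ Fin m) (Fin n ⊕ Fin n ⊕ Fin m) ℝ :=
  (dataMatrix r)ᵀ * noiseMatrix M b * dataMatrix r

def PhiT₁₂ : Matrix (Fin n) (Fin n) ℝ := (PhiT M r b).toBlocks₁₂.toCols₁

def PhiT₁₃ : Matrix (Fin n) (Fin m) ℝ := (PhiT M r b).toBlocks₁₂.toCols₂

def PhiT₂₂ : Matrix (Fin n) (Fin n) ℝ := (PhiT M r b).toBlocks₂₂.toBlocks₁₁

def PhiT₂₃ : Matrix (Fin n) (Fin m) ℝ := (PhiT M r b).toBlocks₂₂.toBlocks₁₂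

def PhiT₃₃ : Matrix (Fin m) (Fin m) ℝ := (PhiT M r b).toBlocks₂₂.toBlocks₂₂

end Data

section Synthesis

variable {n m p q l N nt qt : ℕ} (M : KnownModel n m p q l) (r : Recording n m N)
  (b : NoiseBound p N) (s : Supply p q)
  (As : Matrix (Fin n) (Fin n) ℝ) (Bs : Matrix (Fin n) (Fin m) ℝ)
  (Ξ : Matrix (Fin n) (Fin nt) ℝ) (Λ : Matrix (Fin nt) (Fin nt) ℝ)
  (T : Matrix (Fin q) (Fin qt) ℝ) (Rt : Matrix (Fin qt) (Fin qt) ℝ)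
  (d : Decision n m l)

/-- The block `Π₁₁`, with
`G₁ = C₁ + E D_c C`, `G₂ = C₁ Y + E C̃_c`, `G₃ = D₁ + E D_c F`. -/
noncomputable def Pi₁₁ : Matrix (Fin n ⊕ Fin n ⊕ Fin p ⊕ Fin qt) (Fin n ⊕ Fin n ⊕ Fin p ⊕ Fin qt) ℝ :=
  let G₁ := M.C₁ + M.E * d.Dc * M.C
  let G₂ := M.C₁ * d.Y + M.E * d.Ct
  let G₃ := M.D₁ + M.E * d.Dc * M.F
  (d.X ◨ 1 ◨ (-(s.S * G₁))ᵀ ◨ (Tᵀ * G₁)ᵀ) ⬓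
  (1 ◨ d.Y ◨ (-(s.S * G₂))ᵀ ◨ (Tᵀ * G₂)ᵀ) ⬓
  (-(s.S * G₁) ◨ -(s.S * G₂) ◨ (-s.Q - ((s.S * G₃)ᵀ + s.S * G₃)) ◨ (Tᵀ * G₃)ᵀ) ⬓
  (Tᵀ * G₁ ◨ Tᵀ * G₂ ◨ Tᵀ * G₃ ◨ Rt⁻¹)

/-- The transpose of the block `Π₁₂`. -/
def Pi₁₂T : Matrix (Fin n ⊕ Fin n ⊕ Fin n ⊕ Fin m ⊕ Fin nt)
    (Fin n ⊕ Fin n ⊕ Fin p ⊕ Fin qt) ℝ :=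
  ((As + Bs * d.Dc * M.C) ◨ (As * d.Y + Bs * d.Ct) ◨ (M.B₁ + Bs * d.Dc * M.F) ◨ 0) ⬓
  ((d.X * As + d.Bt * M.C) ◨ d.At ◨ (d.X * M.B₁ + d.Bt * M.F) ◨ 0) ⬓
  (1 ◨ d.Y ◨ 0 ◨ 0) ⬓
  (d.Dc * M.C ◨ d.Ct ◨ d.Dc * M.F ◨ 0) ⬓
  (0 ◨ 0 ◨ 0 ◨ 0)

/-- The block `Π₂₂`, with `H₂ = Φ̃₁₂ + A_s Φ̃₂₂ + B_s Φ̃₂₃ᵀ`, `H₃ = Φ̃₁₃ + A_s Φ̃₂₃ + B_s Φ̃₃₃`. -/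
noncomputable def Pi₂₂ : Matrix (Fin n ⊕ Fin n ⊕ Fin n ⊕ Fin m ⊕ Fin nt)
    (Fin n ⊕ Fin n ⊕ Fin n ⊕ Fin m ⊕ Fin nt) ℝ :=
  let H₂ := PhiT₁₂ M r b + As * PhiT₂₂ M r b + Bs * (PhiT₂₃ M r b)ᵀ
  let H₃ := PhiT₁₃ M r b + As * PhiT₂₃ M r b + Bs * PhiT₃₃ M r b
  (d.Y ◨ 1 ◨ (-d.α) • H₂ ◨ (-d.α) • H₃ ◨ d.α • Ξ) ⬓
  (1 ◨ d.X ◨ (-d.α) • (d.X * H₂) ◨ (-d.α) • (d.X * H₃) ◨ d.α • (d.X * Ξ)) ⬓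
  (((-d.α) • H₂)ᵀ ◨ ((-d.α) • (d.X * H₂))ᵀ ◨
    (-d.α) • PhiT₂₂ M r b ◨ (-d.α) • PhiT₂₃ M r b ◨ 0) ⬓
  (((-d.α) • H₃)ᵀ ◨ ((-d.α) • (d.X * H₃))ᵀ ◨
    ((-d.α) • PhiT₂₃ M r b)ᵀ ◨ (-d.α) • PhiT₃₃ M r b ◨ 0) ⬓
  ((d.α • Ξ)ᵀ ◨ (d.α • (d.X * Ξ))ᵀ ◨ 0 ◨ 0 ◨ d.α • Λ⁻¹)

/-- The synthesis matrix `Π`. -/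
noncomputable def PiMatrix : Matrix
    ((Fin n ⊕ Fin n ⊕ Fin p ⊕ Fin qt) ⊕ (Fin n ⊕ Fin n ⊕ Fin n ⊕ Fin m ⊕ Fin nt))
    ((Fin n ⊕ Fin n ⊕ Fin p ⊕ Fin qt) ⊕ (Fin n ⊕ Fin n ⊕ Fin n ⊕ Fin m ⊕ Fin nt)) ℝ :=
  fromBlocks (Pi₁₁ M s T Rt d) (Pi₁₂T M As Bs d)ᵀ
    (Pi₁₂T M As Bs d) (Pi₂₂ M r b As Bs Ξ Λ d)

/-- `d` is a solution of the synthesis inequality: `X`, `Y` are symmetric and `Π ≻ 0`. -/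
def IsFeasible : Prop :=
  d.X.IsSymm ∧ d.Y.IsSymm ∧ (PiMatrix M r b s As Bs Ξ Λ T Rt d).PosDef

/-- The matrix `V` with `Vᵀ = U⁻¹ (I - X Y)`. -/
noncomputable def recV (U : Matrix (Fin n) (Fin n) ℝ) : Matrix (Fin n) (Fin n) ℝ :=
  (U⁻¹ * (1 - d.X * d.Y))ᵀ

/-- The controller reconstructed from the decision variables and `U`. -/
noncomputable def recController (U : Matrix (Fin n) (Fin n) ℝ) : Controller n m l :=
  let Vt := (recV d U)ᵀ
  let Bc := U⁻¹ * (d.Bt - d.X * Bs * d.Dc)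
  { Ac := U⁻¹ * (d.At - d.X * (As * d.Y + Bs * d.Ct) - U * Bc * M.C * d.Y) * Vt⁻¹
    Bc := Bc
    Cc := (d.Ct - d.Dc * M.C * d.Y) * Vt⁻¹
    Dc := d.Dc }

end Synthesis

end DataDissipativity

open DataDissipativity

/-!
# Synthesis of robustly dissipative controllers from data

A matrix `P` is a storage matrix for all consistent systems if and only if, for some scalar `α`, one
quadratic form is positive definite, and this form becomes that of `Π` under a congruence.

**The consistent systems form a matrix ellipsoid.** Since `Φ₂₂ ≺ 0`, the quadratic inequality on
the residual of the data equation already forces the residual into the range of `B₁`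
(`mem_consistentSystems_iff`). Hence `(As + Δ₁, Bs + Δ₂)` is consistent if and only if `Δ = (Δ₁ Δ₂)`
satisfies `0 ≤ vᵀ Ξ Λ Ξᵀ v + 2 vᵀ H Δᵀ v - vᵀ Δ N Δᵀ v` for all `v`, with `H = (H₂ H₃)` and
`N ≻ 0` by the rank condition (`mem_consistentSystems_add_iff`, `neg_PhiT_toBlocks₂₂_posDef`).

**Fixed storage matrix.** Dissipativity for one `Δ` says that a quadratic form, with slack vectors
in place of the terms quadratic in the closed-loop matrices, is positive at all vectors with
`c = Δᵀ h`. The vectors `(h, c)` reached by some admissible `Δ` are exactly those with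
`0 ≤ hᵀ Ξ Λ Ξᵀ h + 2 hᵀ H c - cᵀ N c` (`exists_uncertainty`, a rank-one construction and
Cauchy–Schwarz). So robust dissipativity is positivity of one quadratic form where another one is
nonpositive, and the strict S-lemma `IsQuadratic.exists_multiplier` supplies the multiplier `α`.
No Slater point is needed because the inequality is strict, and thus `Ξ` may be singular. The
result is `robustlyDissipative_iff`.

**Linearizing change of variables.** For `P = (X, U; Uᵀ, X̂)` with `P⁻¹ = (Y, V; Vᵀ, *)`, the
congruence with `(I, Y; 0, Vᵀ)` turns the form into that of `Π` (`synthesisForm_eq`), and preserves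
positivity if `V` is invertible. From a controller to `Π ≻ 0`, a small perturbation of `P` makes `U`,
and with it `V`, invertible (`exists_isFeasible`). Conversely `Π ≻ 0` makes `I - X Y` invertible, and
`X̂ = -Uᵀ Y V⁻ᵀ` completes the storage matrix (`isUnit_recV_and_exists_storage`).
-/

namespace DataDissipativity

/-! ### Quadratic forms and the strict S-lemma -/

section Quadratic

variable {E : Type*} [NormedAddCommGroup E] [NormedSpace ℝ E]

/-- `f` is a continuous quadratic form, expressed by its values along affine lines. -/
def IsQuadratic (f : E → ℝ) : Prop :=
  Continuous f ∧ ∀ (t : ℝ) (u w : E),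
    f (t • u + w) = t ^ 2 * f u + t * (f (u + w) - f u - f w) + f w

namespace IsQuadratic

variable {f g : E → ℝ}

lemma map_zero (hf : IsQuadratic f) : f 0 = 0 := by
  have := hf.2 2 0 0
  simp only [smul_zero, add_zero] at this
  linarith

lemma map_smul (hf : IsQuadratic f) (t : ℝ) (u : E) : f (t • u) = t ^ 2 * f u := by
  have := hf.2 t u 0
  simp only [add_zero, hf.map_zero] at this
  rw [this]; ring

lemma add (hf : IsQuadratic f) (hg : IsQuadratic g) : IsQuadratic fun v => f v + g v :=
  ⟨hf.1.add hg.1, fun t u w => by simp only [hf.2 t u w, hg.2 t u w]; ring⟩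

lemma const_mul (hf : IsQuadratic f) (c : ℝ) : IsQuadratic fun v => c * f v :=
  ⟨hf.1.const_mul c, fun t u w => by simp only [hf.2 t u w]; ring⟩

lemma dotProduct [FiniteDimensional ℝ E] {ι : Type*} [Fintype ι] {L M : E → ι → ℝ}
    (hL : IsLinearMap ℝ L) (hM : IsLinearMap ℝ M) : IsQuadratic fun v => L v ⬝ᵥ M v := by
  constructor
  · have h1 : Continuous L := (hL.mk' L).continuous_of_finiteDimensional
    have h2 : Continuous M := (hM.mk' M).continuous_of_finiteDimensional
    exact h1.dotProduct h2
  · intro t u w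
    simp only [hL.map_add, hL.map_smul, hM.map_add, hM.map_smul, add_dotProduct, dotProduct_add,
      smul_dotProduct, dotProduct_smul, smul_eq_mul]
    ring

/-- A quadratic form takes the sign of its values on the unit sphere. -/
lemma pos_of_sphere (hf : IsQuadratic f) (h : ∀ u, ‖u‖ = 1 → 0 < f u) {v : E} (hv : v ≠ 0) :
    0 < f v := by
  have hn : 0 < ‖v‖ := norm_pos_iff.2 hv
  have h1 := h (‖v‖⁻¹ • v) (by rw [norm_smul, norm_inv, norm_norm, inv_mul_cancel₀ hn.ne'])
  rw [hf.map_smul] at h1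
  exact (mul_pos_iff_of_pos_left (by positivity)).1 h1

/-- Positive definiteness is an open condition. -/
lemma pos_add_mul [FiniteDimensional ℝ E] (hf : IsQuadratic f) (hg : IsQuadratic g)
    (h : ∀ v, v ≠ 0 → 0 < f v) :
    ∃ ε > 0, ∀ t : ℝ, |t| ≤ ε → ∀ v, v ≠ 0 → 0 < f v + t * g v := by
  have hK := isCompact_sphere (0 : E) 1
  obtain ⟨m, hm, hfm⟩ := hK.exists_forall_le' hf.1.continuousOn (a := 0) fun v hv =>
    h v (ne_zero_of_mem_unit_sphere ⟨v, hv⟩)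
  obtain ⟨c, hc⟩ := hK.exists_bound_of_continuousOn hg.1.continuousOn
  refine ⟨m / (2 * (|c| + 1)), by positivity, fun t ht v hv => ?_⟩
  refine (hf.add (hg.const_mul t)).pos_of_sphere (fun u hu => ?_) hv
  have hu' : u ∈ Metric.sphere (0 : E) 1 := by simpa using hu
  have h1 := hfm u hu'
  have h2 : |t * g u| ≤ m / (2 * (|c| + 1)) * (|c| + 1) := by
    rw [abs_mul]
    have h3 := hc u hu'
    rw [Real.norm_eq_abs] at h3
    gcongr
    linarith [le_abs_self c]
  have h4 : m / (2 * (|c| + 1)) * (|c| + 1) = m / 2 := by field_simp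
  have := neg_abs_le (t * g u)
  linarith

lemma exists_pos [FiniteDimensional ℝ E] :
    ∃ g : E → ℝ, IsQuadratic g ∧ ∀ v, v ≠ 0 → 0 < g v := by
  refine ⟨fun v => ‖toEuclidean v‖ ^ 2, ⟨by fun_prop, fun t u w => ?_⟩, fun v hv => ?_⟩
  · simp only [_root_.map_add, _root_.map_smul, norm_add_sq_real, norm_smul, mul_pow,
      real_inner_smul_left, Real.norm_eq_abs, sq_abs]
    ring
  · have : toEuclidean v ≠ 0 := by simpa using hv
    positivity

/-- The planar case of the S-lemma: on the span of `u` and `w` the form `g` vanishes on two lines,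
and the values of `f` on these lines bound the values at `u` and `w`. -/
lemma mul_lt_mul_of_pos_of_zero (hf : IsQuadratic f) (hg : IsQuadratic g)
    (h : ∀ v, v ≠ 0 → g v ≤ 0 → 0 < f v) {u w : E} (hu : 0 < g u) (hw : g w < 0) :
    f u * g w < f w * g u := by
  set a := g u
  set c := g w
  set b := g (u + w) - g u - g w with hb
  set s := √(b ^ 2 - 4 * a * c)
  have hD : 0 ≤ b ^ 2 - 4 * a * c := by nlinarith [mul_pos hu (neg_pos.2 hw), sq_nonneg b]
  have hs : s ^ 2 = b ^ 2 - 4 * a * c := Real.sq_sqrt hD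
  have hsb : |b| < s := by
    refine abs_lt_of_sq_lt_sq ?_ (Real.sqrt_nonneg _)
    nlinarith [mul_pos hu (neg_pos.2 hw)]
  obtain ⟨hb1, hb2⟩ := abs_lt.1 hsb
  have key : ∀ t, a * t ^ 2 + b * t + c = 0 →
      0 < t ^ 2 * f u + t * (f (u + w) - f u - f w) + f w := by
    intro t ht
    rw [← hf.2]
    have h0 : g (t • u + w) = 0 := by
      rw [hg.2, ← ht]; ring
    refine h _ (fun h1 => ?_) h0.le
    have h2 : w = (-t) • u := by
      rw [neg_smul]; exact eq_neg_of_add_eq_zero_right h1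
    have h3 : c = (-t) ^ 2 * a := by rw [← hg.map_smul, ← h2]
    have : 0 ≤ (-t) ^ 2 * a := by positivity
    linarith
  -- the two roots of `g (t • u + w)` as a function of `t`
  set t₁ := (-b + s) / (2 * a) with ht₁
  set t₂ := (-b - s) / (2 * a) with ht₂
  have p1 : 0 < t₁ := div_pos (by linarith) (by linarith)
  have p2 : t₂ < 0 := div_neg_of_neg_of_pos (by linarith) (by linarith)
  have r1 : a * t₁ ^ 2 + b * t₁ + c = 0 := by
    rw [ht₁]; field_simp; nlinarith
  have r2 : a * t₂ ^ 2 + b * t₂ + c = 0 := by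
    rw [ht₂]; field_simp; nlinarith
  have r12 : a * (t₁ * t₂) = c := by
    rw [ht₁, ht₂]; field_simp; nlinarith
  have k1 := mul_pos (neg_pos.2 p2) (key t₁ r1)
  have k2 := mul_pos p1 (key t₂ r2)
  have k3 : 0 < (t₁ - t₂) * (f w - t₁ * t₂ * f u) := by nlinarith
  have k4 : 0 < f w - t₁ * t₂ * f u := (mul_pos_iff_of_pos_left (by linarith)).1 k3
  rw [← r12]
  nlinarith [mul_pos hu k4]

/-- The strict S-lemma, which needs no constraint qualification: if `f` is positive where `g` is
nonpositive, then `f + α g` is positive definite for some multiplier `α`. -/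
theorem exists_multiplier [FiniteDimensional ℝ E] (hf : IsQuadratic f) (hg : IsQuadratic g)
    (h : ∀ v, v ≠ 0 → g v ≤ 0 → 0 < f v) :
    ∃ α > 0, ∀ v, v ≠ 0 → 0 < f v + α * g v := by
  have hS := isCompact_sphere (0 : E) 1
  have hS0 : ∀ v ∈ Metric.sphere (0 : E) 1, v ≠ 0 := fun v hv =>
    ne_zero_of_mem_unit_sphere ⟨v, hv⟩
  by_cases hneg : ∃ w, g w < 0
  · obtain ⟨w₀, hw₀⟩ := hneg
    obtain ⟨k, hk, hkpos⟩ := exists_pos (E := E)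
    -- subtract a small positive form from `f` to turn the final strict inequality into a weak one
    obtain ⟨m, hm, hfm⟩ := (hS.inter_right (isClosed_Iic.preimage hg.1)).exists_forall_le'
      hf.1.continuousOn (a := 0) fun v hv => h v (hS0 v hv.1) hv.2
    obtain ⟨c, hc⟩ := hS.exists_bound_of_continuousOn hk.1.continuousOn
    set ε := m / (2 * (|c| + 1))
    have hε : 0 < ε := by positivity
    have hf' : IsQuadratic fun v => f v + (-ε) * k v := hf.add (hk.const_mul _)
    have h' : ∀ v, v ≠ 0 → g v ≤ 0 → 0 < f v + (-ε) * k v := by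
      intro v hv hgv
      have hn : 0 < ‖v‖ := norm_pos_iff.2 hv
      set u := ‖v‖⁻¹ • v
      have hu : u ∈ Metric.sphere (0 : E) 1 := by
        simp [u, norm_smul, inv_mul_cancel₀ hn.ne']
      have hgu : g u ≤ 0 := by
        rw [hg.map_smul]; exact mul_nonpos_of_nonneg_of_nonpos (by positivity) hgv
      have h1 := hfm u ⟨hu, hgu⟩
      have h2 := hc u hu
      rw [Real.norm_eq_abs] at h2
      have h3 : ε * k u ≤ ε * (|c| + 1) := by
        gcongr
        linarith [le_abs_self c, le_abs_self (k u)]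
      have h4 : ε * (|c| + 1) = m / 2 := by simp only [ε]; field_simp
      have h5 : 0 < f u + (-ε) * k u := by linarith
      have h6 : f u + (-ε) * k u = ‖v‖⁻¹ ^ 2 * (f v + (-ε) * k v) := hf'.map_smul _ _
      rw [h6] at h5
      exact (mul_pos_iff_of_pos_left (by positivity)).1 h5
    set F : E → ℝ := fun v => f v + (-ε) * k v with hF
    let L : Set ℝ := insert 0 {a | ∃ u, 0 < g u ∧ a = -F u / g u}
    have hub : ∀ w, g w < 0 → ∀ a ∈ L, a ≤ F w / (-g w) := by
      rintro w hw a (rfl | ⟨u, hu, rfl⟩)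
      · have hw0 : w ≠ 0 := by rintro rfl; rw [hg.map_zero] at hw; exact hw.false
        exact div_nonneg (h' w hw0 hw.le).le (by linarith)
      · have := hf'.mul_lt_mul_of_pos_of_zero hg h' hu hw
        rw [div_le_div_iff₀ hu (by linarith)]
        linarith
    have hbdd : BddAbove L := ⟨_, hub w₀ hw₀⟩
    have hα : 0 ≤ sSup L := le_csSup hbdd (Set.mem_insert _ _)
    have hα' : ∀ v, v ≠ 0 → 0 < f v + sSup L * g v := by
      intro v hv
      have hkv := mul_pos hε (hkpos v hv)
      suffices 0 ≤ F v + sSup L * g v by simp only [hF] at this; linarith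
      rcases lt_trichotomy (g v) 0 with hv' | hv' | hv'
      · have := csSup_le (Set.insert_nonempty _ _) (hub v hv')
        rw [le_div_iff₀ (by linarith)] at this
        linarith
      · rw [hv', mul_zero, add_zero]
        exact (h' v hv hv'.le).le
      · have := le_csSup hbdd (Set.mem_insert_of_mem 0 ⟨v, hv', rfl⟩)
        rw [div_le_iff₀ hv'] at this
        linarith
    obtain ⟨t, ht, hpos⟩ := (hf.add (hg.const_mul (sSup L))).pos_add_mul hg hα'
    refine ⟨sSup L + t, by linarith, fun v hv => ?_⟩
    have := hpos t (abs_of_pos ht).le v hv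
    linarith
  · push Not at hneg
    obtain ⟨δ, hδ, hgδ⟩ := (hS.inter_right (isClosed_Iic.preimage hf.1)).exists_forall_le'
      hg.1.continuousOn (a := 0) fun v hv => by
        by_contra h0
        exact absurd (h v (hS0 v hv.1) (not_lt.1 h0)) (not_lt.2 hv.2)
    obtain ⟨c, hc⟩ := hS.exists_bound_of_continuousOn hf.1.continuousOn
    have hα : 0 < |c| / δ + 1 := by positivity
    refine ⟨|c| / δ + 1, hα, fun v hv => ?_⟩
    refine (hf.add (hg.const_mul _)).pos_of_sphere (fun u hu => ?_) hv
    have hu' : u ∈ Metric.sphere (0 : E) 1 := by simpa using hu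
    by_cases hfu : f u ≤ 0
    · have h1 := mul_le_mul_of_nonneg_left (hgδ u ⟨hu', hfu⟩) hα.le
      have h2 := hc u hu'
      rw [Real.norm_eq_abs] at h2
      have h3 : (|c| / δ + 1) * δ = |c| + δ := by field_simp
      linarith [neg_abs_le (f u), le_abs_self c]
    · have := mul_nonneg hα.le (hneg u)
      linarith

end IsQuadratic

end Quadratic

/-! ### Uncertainties obeying a quadratic bound -/

section Realization

variable {ν κ : Type*} [Fintype ν] [Fintype κ] [DecidableEq κ]

/-- The quadratic form that bounds the uncertainty `Δ` by `0 ≤ uncertaintyForm Γ H N v (Δᵀ v)`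
for all `v`. -/
def uncertaintyForm (Γ : Matrix ν ν ℝ) (H : Matrix ν κ ℝ) (N : Matrix κ κ ℝ)
    (v : ν → ℝ) (c : κ → ℝ) : ℝ :=
  v ⬝ᵥ Γ *ᵥ v + 2 * (v ⬝ᵥ H *ᵥ c) - c ⬝ᵥ N *ᵥ c

lemma dotProduct_mulVec_comm_of_isSymm {ι : Type*} [Fintype ι] {A : Matrix ι ι ℝ}
    (hA : A.IsSymm) (u v : ι → ℝ) :
    u ⬝ᵥ A *ᵥ v = v ⬝ᵥ A *ᵥ u := by
  rw [dotProduct_mulVec, ← mulVec_transpose, hA.eq, dotProduct_comm]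

/-- The Cauchy–Schwarz inequality for a positive semidefinite matrix. -/
lemma sq_dotProduct_mulVec_le {ι : Type*} [Fintype ι] {A : Matrix ι ι ℝ}
    (hA : A.PosSemidef) (u v : ι → ℝ) :
    (u ⬝ᵥ A *ᵥ v) ^ 2 ≤ (u ⬝ᵥ A *ᵥ u) * (v ⬝ᵥ A *ᵥ v) := by
  have h : ∀ t : ℝ, 0 ≤ (u ⬝ᵥ A *ᵥ u) * (t * t) + 2 * (u ⬝ᵥ A *ᵥ v) * t + v ⬝ᵥ A *ᵥ v := by
    intro t
    have h0 := hA.dotProduct_mulVec_nonneg (t • u + v)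
    have hs : v ⬝ᵥ A *ᵥ u = u ⬝ᵥ A *ᵥ v :=
      dotProduct_mulVec_comm_of_isSymm hA.isHermitian _ _
    simp only [star_trivial, mulVec_add, mulVec_smul, add_dotProduct, dotProduct_add,
      smul_dotProduct, dotProduct_smul, smul_eq_mul, hs] at h0
    linarith
  have := discrim_le_zero h
  rw [discrim] at this
  linarith

/-- Every vector pair compatible with the bound is produced by an uncertainty that obeys the
bound. -/
lemma exists_uncertainty {Γ : Matrix ν ν ℝ} {H : Matrix ν κ ℝ} {N : Matrix κ κ ℝ}
    (hΓ : Γ.PosSemidef) (hN : N.PosDef) {v : ν → ℝ} {c : κ → ℝ}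
    (h : 0 ≤ uncertaintyForm Γ H N v c) :
    ∃ Δ : Matrix ν κ ℝ, Δᵀ *ᵥ v = c ∧ ∀ w, 0 ≤ uncertaintyForm Γ H N w (Δᵀ *ᵥ w) := by
  have hNN : ∀ x, N *ᵥ (N⁻¹ *ᵥ x) = x := fun x => by
    rw [mulVec_mulVec, mul_nonsing_inv _ ((isUnit_iff_isUnit_det _).1 hN.isUnit), one_mulVec]
  have hNs : N.IsSymm := hN.isHermitian
  -- completing the square
  set G : Matrix ν ν ℝ := Γ + H * N⁻¹ * Hᵀ with hG
  have hGp : G.PosSemidef := hΓ.add (hN.inv.posSemidef.mul_mul_conjTranspose_same H)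
  have hsq : ∀ w y, uncertaintyForm Γ H N w (N⁻¹ *ᵥ Hᵀ *ᵥ w + y)
      = w ⬝ᵥ G *ᵥ w - y ⬝ᵥ N *ᵥ y := by
    intro w y
    have e1 : ∀ x, w ⬝ᵥ H *ᵥ x = x ⬝ᵥ Hᵀ *ᵥ w := fun x => by
      rw [dotProduct_mulVec, ← mulVec_transpose, dotProduct_comm]
    have e2 : (N⁻¹ *ᵥ Hᵀ *ᵥ w) ⬝ᵥ N *ᵥ y = y ⬝ᵥ Hᵀ *ᵥ w := by
      rw [dotProduct_mulVec_comm_of_isSymm hNs, hNN]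
    simp only [uncertaintyForm, hG, mulVec_add, add_mulVec, add_dotProduct, dotProduct_add, e2, hNN,
      ← mulVec_mulVec, e1]
    ring
  set y := c - N⁻¹ *ᵥ Hᵀ *ᵥ v with hy
  have hc : c = N⁻¹ *ᵥ Hᵀ *ᵥ v + y := by rw [hy]; abel
  rw [hc, hsq] at h
  have hNi : (N⁻¹)ᵀ = N⁻¹ := by rw [transpose_nonsing_inv, hNs.eq]
  rcases (hGp.dotProduct_mulVec_nonneg v).eq_or_lt with h0 | h0
  · rw [star_trivial] at h0
    have hy0 : y = 0 := by
      by_contra hne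
      have := hN.dotProduct_mulVec_pos hne
      rw [star_trivial] at this
      linarith
    refine ⟨H * N⁻¹, ?_, fun w => ?_⟩
    · rw [hc, hy0, add_zero, transpose_mul, hNi, mulVec_mulVec]
    · have := hsq w 0
      rw [add_zero] at this
      rw [transpose_mul, hNi, ← mulVec_mulVec, this]
      simpa using hGp.dotProduct_mulVec_nonneg w
  · rw [star_trivial] at h0
    set a := v ⬝ᵥ G *ᵥ v
    have hΔ : ∀ w, (H * N⁻¹ + a⁻¹ • vecMulVec (G *ᵥ v) y)ᵀ *ᵥ w
        = N⁻¹ *ᵥ Hᵀ *ᵥ w + (a⁻¹ * (w ⬝ᵥ G *ᵥ v)) • y := by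
      intro w
      rw [transpose_add, add_mulVec, transpose_mul, hNi, mulVec_mulVec, transpose_smul,
        transpose_vecMulVec, smul_mulVec, vecMulVec_mulVec, mul_smul, dotProduct_comm w]
      simp
    refine ⟨H * N⁻¹ + a⁻¹ • vecMulVec (G *ᵥ v) y, ?_, fun w => ?_⟩
    · rw [hΔ, inv_mul_cancel₀ h0.ne', one_smul, ← hc]
    · rw [hΔ, hsq, mulVec_smul, smul_dotProduct, dotProduct_smul, smul_eq_mul, smul_eq_mul]
      have h1 := sq_dotProduct_mulVec_le hGp w v
      have h2 : (a⁻¹ * (w ⬝ᵥ G *ᵥ v)) * ((a⁻¹ * (w ⬝ᵥ G *ᵥ v)) * (y ⬝ᵥ N *ᵥ y))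
          ≤ (a⁻¹ * (w ⬝ᵥ G *ᵥ v)) * ((a⁻¹ * (w ⬝ᵥ G *ᵥ v)) * a) := by
        have hya : y ⬝ᵥ N *ᵥ y ≤ a := by linarith
        have := mul_le_mul_of_nonneg_left hya (mul_self_nonneg (a⁻¹ * (w ⬝ᵥ G *ᵥ v)))
        linarith
      have h3 : (a⁻¹ * (w ⬝ᵥ G *ᵥ v)) * ((a⁻¹ * (w ⬝ᵥ G *ᵥ v)) * a)
          = (w ⬝ᵥ G *ᵥ v) ^ 2 / a := by field_simp
      have h4 : (w ⬝ᵥ G *ᵥ v) ^ 2 / a ≤ w ⬝ᵥ G *ᵥ w := by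
        rw [div_le_iff₀ h0]; exact h1
      linarith

end Realization

/-! ### Robust dissipativity for a fixed storage matrix -/

section RobustForm

/-- An uncertain system `x⁺ = (A + J Δ G) x + (B + J Δ G') w`, `z = C x + D w`. -/
structure UncertainLoop (ι ν κ : Type*) (p q : ℕ) where
  A : Matrix ι ι ℝ
  B : Matrix ι (Fin p) ℝ
  C : Matrix (Fin q) ι ℝ
  D : Matrix (Fin q) (Fin p) ℝ
  J : Matrix ι ν ℝ
  G : Matrix κ ι ℝ
  G' : Matrix κ (Fin p) ℝ

variable {ι ν κ : Type*} [Fintype ι] [Fintype ν] [Fintype κ] {p q nt qt : ℕ}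

/-- The supply rate at `(w, z)`, with the term `-zᵀ R z`, `R = T R̃ Tᵀ`, replaced by
terms linear in `z` at the price of the slack vector `ρ`. -/
noncomputable def slackSupply (s : Supply p q) (T : Matrix (Fin q) (Fin qt) ℝ)
    (Rt : Matrix (Fin qt) (Fin qt) ℝ) (w : Fin p → ℝ) (ρ : Fin qt → ℝ) (z : Fin q → ℝ) : ℝ :=
  -2 * (w ⬝ᵥ s.S *ᵥ z) - w ⬝ᵥ s.Q *ᵥ w + 2 * (ρ ⬝ᵥ Tᵀ *ᵥ z) + ρ ⬝ᵥ Rt⁻¹ *ᵥ ρ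

/-- The negative of `uncertaintyForm (Ξ Λ Ξᵀ) H N`, with the quadratic term in `h` replaced by terms
linear in `h` at the price of the slack vector `e`. -/
noncomputable def multiplierForm (H : Matrix ν κ ℝ) (N : Matrix κ κ ℝ)
    (Ξ : Matrix ν (Fin nt) ℝ) (Λ : Matrix (Fin nt) (Fin nt) ℝ)
    (h : ν → ℝ) (c : κ → ℝ) (e : Fin nt → ℝ) : ℝ :=
  -2 * (h ⬝ᵥ H *ᵥ c) + 2 * (h ⬝ᵥ Ξ *ᵥ e) + c ⬝ᵥ N *ᵥ c + e ⬝ᵥ Λ⁻¹ *ᵥ e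

/-- The quadratic form whose positivity certifies that `xᵀ P x` is a storage function of the
uncertain loop for all admissible uncertainties; `α` is the multiplier of the uncertainty bound. -/
noncomputable def robustForm (L : UncertainLoop ι ν κ p q) (s : Supply p q)
    (T : Matrix (Fin q) (Fin qt) ℝ) (Rt : Matrix (Fin qt) (Fin qt) ℝ)
    (H : Matrix ν κ ℝ) (N : Matrix κ κ ℝ) (Ξ : Matrix ν (Fin nt) ℝ)
    (Λ : Matrix (Fin nt) (Fin nt) ℝ) (P : Matrix ι ι ℝ) (α : ℝ)
    (ξ : ι → ℝ) (w : Fin p → ℝ) (ρ : Fin qt → ℝ) (b : ι → ℝ) (c : κ → ℝ) (e : Fin nt → ℝ) : ℝ :=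
  ξ ⬝ᵥ P *ᵥ ξ + slackSupply s T Rt w ρ (L.C *ᵥ ξ + L.D *ᵥ w)
    + 2 * ((P *ᵥ b) ⬝ᵥ (L.A *ᵥ ξ + L.B *ᵥ w)) + b ⬝ᵥ P *ᵥ b
    + 2 * (c ⬝ᵥ (L.G *ᵥ ξ + L.G' *ᵥ w)) + α * multiplierForm H N Ξ Λ (L.Jᵀ *ᵥ P *ᵥ b) c e

lemma dotProduct_transpose_mulVec_comm {l k : Type*} [Fintype l] [Fintype k] (A : Matrix l k ℝ)
    (u : k → ℝ) (v : l → ℝ) : u ⬝ᵥ Aᵀ *ᵥ v = v ⬝ᵥ A *ᵥ u := by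
  rw [dotProduct_mulVec, vecMul_transpose, dotProduct_comm]

lemma inv_mulVec_mulVec_of_posDef {k : Type*} [Fintype k] [DecidableEq k] {A : Matrix k k ℝ}
    (hA : A.PosDef) (x : k → ℝ) : A⁻¹ *ᵥ A *ᵥ x = x := by
  rw [mulVec_mulVec, nonsing_inv_mul _ ((isUnit_iff_isUnit_det _).1 hA.isUnit), one_mulVec]

/-- Completing a square whose linear part is given through `Aᵀ`. -/
lemma complete_square {k l : Type*} [Fintype k] [DecidableEq k] [Fintype l]
    {A : Matrix k k ℝ} (hA : A.PosDef) (B : Matrix l k ℝ) (ρ : k → ℝ) (z : l → ℝ) :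
    (ρ + A *ᵥ Bᵀ *ᵥ z) ⬝ᵥ A⁻¹ *ᵥ (ρ + A *ᵥ Bᵀ *ᵥ z)
      = ρ ⬝ᵥ A⁻¹ *ᵥ ρ + 2 * (z ⬝ᵥ B *ᵥ ρ) + z ⬝ᵥ (B * A * Bᵀ) *ᵥ z := by
  have h1 : (A *ᵥ Bᵀ *ᵥ z) ⬝ᵥ A⁻¹ *ᵥ ρ = ρ ⬝ᵥ Bᵀ *ᵥ z := by
    have hAs : A⁻¹.IsSymm := hA.inv.isHermitian
    rw [dotProduct_mulVec_comm_of_isSymm hAs, inv_mulVec_mulVec_of_posDef hA]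
  have h2 : (A *ᵥ Bᵀ *ᵥ z) ⬝ᵥ Bᵀ *ᵥ z = z ⬝ᵥ (B * A * Bᵀ) *ᵥ z := by
    rw [dotProduct_transpose_mulVec_comm, ← mulVec_mulVec, ← mulVec_mulVec]
  simp only [mulVec_add, add_dotProduct, dotProduct_add, inv_mulVec_mulVec_of_posDef hA, h1, h2,
    dotProduct_transpose_mulVec_comm]
  ring

variable {L : UncertainLoop ι ν κ p q} {s : Supply p q}
    {T : Matrix (Fin q) (Fin qt) ℝ} {Rt : Matrix (Fin qt) (Fin qt) ℝ}
    {H : Matrix ν κ ℝ} {N : Matrix κ κ ℝ} {Ξ : Matrix ν (Fin nt) ℝ}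
    {Λ : Matrix (Fin nt) (Fin nt) ℝ} {P : Matrix ι ι ℝ}

lemma slackSupply_eq (hRt : Rt.PosDef) (hT : s.R = T * Rt * Tᵀ)
    (w : Fin p → ℝ) (ρ : Fin qt → ℝ) (z : Fin q → ℝ) :
    slackSupply s T Rt w ρ z = (ρ + Rt *ᵥ Tᵀ *ᵥ z) ⬝ᵥ Rt⁻¹ *ᵥ (ρ + Rt *ᵥ Tᵀ *ᵥ z)
      - (w ⬝ᵥ s.Q *ᵥ w + 2 * (w ⬝ᵥ s.S *ᵥ z) + z ⬝ᵥ s.R *ᵥ z) := by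
  rw [complete_square hRt, hT, slackSupply, dotProduct_transpose_mulVec_comm]
  ring

lemma multiplierForm_eq (hΛ : Λ.PosDef) (h : ν → ℝ) (c : κ → ℝ) (e : Fin nt → ℝ) :
    multiplierForm H N Ξ Λ h c e = (e + Λ *ᵥ Ξᵀ *ᵥ h) ⬝ᵥ Λ⁻¹ *ᵥ (e + Λ *ᵥ Ξᵀ *ᵥ h)
      - uncertaintyForm (Ξ * Λ * Ξᵀ) H N h c := by
  rw [complete_square hΛ, multiplierForm, uncertaintyForm]
  ring

lemma dissipationMatrix_form [DecidableEq ι] (s : Supply p q) (P A : Matrix ι ι ℝ)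
    (B : Matrix ι (Fin p) ℝ) (C : Matrix (Fin q) ι ℝ) (D : Matrix (Fin q) (Fin p) ℝ)
    (ξ : ι → ℝ) (w : Fin p → ℝ) :
    Sum.elim ξ w ⬝ᵥ dissipationMatrix s P A B C D *ᵥ Sum.elim ξ w
      = (A *ᵥ ξ + B *ᵥ w) ⬝ᵥ P *ᵥ (A *ᵥ ξ + B *ᵥ w) - ξ ⬝ᵥ P *ᵥ ξ
        + (w ⬝ᵥ s.Q *ᵥ w + 2 * (w ⬝ᵥ s.S *ᵥ (C *ᵥ ξ + D *ᵥ w))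
          + (C *ᵥ ξ + D *ᵥ w) ⬝ᵥ s.R *ᵥ (C *ᵥ ξ + D *ᵥ w)) := by
  have hJ : ((1 ◨ 0 ⬓ A ◨ B) ⬓ (0 ◨ 1 ⬓ C ◨ D) :
      Matrix ((ι ⊕ ι) ⊕ (Fin p ⊕ Fin q)) (ι ⊕ Fin p) ℝ) *ᵥ Sum.elim ξ w
      = Sum.elim (Sum.elim ξ (A *ᵥ ξ + B *ᵥ w)) (Sum.elim w (C *ᵥ ξ + D *ᵥ w)) := by
    simp only [fromRows_mulVec, fromCols_mulVec_sumElim, one_mulVec, zero_mulVec, add_zero,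
      zero_add]
  simp only [dissipationMatrix]
  rw [Matrix.mul_assoc, ← mulVec_mulVec, dotProduct_transpose_mulVec_comm, ← mulVec_mulVec, hJ,
    dotProduct_comm]
  simp only [fromBlocks_mulVec, Sum.elim_comp_inl, Sum.elim_comp_inr, sumElim_dotProduct_sumElim,
    zero_mulVec, add_zero, zero_add, neg_mulVec, dotProduct_neg, dotProduct_add,
    dotProduct_transpose_mulVec_comm]
  ring

lemma dissipationMatrix_isSymm [DecidableEq ι] (hQ : s.Q.IsSymm) (hR : s.R.IsSymm)
    (hP : P.IsSymm) (A : Matrix ι ι ℝ) (B : Matrix ι (Fin p) ℝ) (C : Matrix (Fin q) ι ℝ)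
    (D : Matrix (Fin q) (Fin p) ℝ) : (dissipationMatrix s P A B C D).IsSymm := by
  simp only [dissipationMatrix, IsSymm, transpose_mul, transpose_transpose, fromBlocks_transpose,
    transpose_neg, transpose_zero, hP.eq, hQ.eq, hR.eq, Matrix.mul_assoc]

lemma strictlyDissipative_iff [DecidableEq ι] (hQ : s.Q.IsSymm) (hR : s.R.IsSymm)
    (hP : P.IsSymm) {A : Matrix ι ι ℝ} {B : Matrix ι (Fin p) ℝ} {C : Matrix (Fin q) ι ℝ}
    {D : Matrix (Fin q) (Fin p) ℝ} :
    StrictlyDissipative s P A B C D ↔ ∀ ξ w, (ξ ≠ 0 ∨ w ≠ 0) →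
      (A *ᵥ ξ + B *ᵥ w) ⬝ᵥ P *ᵥ (A *ᵥ ξ + B *ᵥ w) - ξ ⬝ᵥ P *ᵥ ξ
        + (w ⬝ᵥ s.Q *ᵥ w + 2 * (w ⬝ᵥ s.S *ᵥ (C *ᵥ ξ + D *ᵥ w))
          + (C *ᵥ ξ + D *ᵥ w) ⬝ᵥ s.R *ᵥ (C *ᵥ ξ + D *ᵥ w)) < 0 := by
  constructor
  · intro h ξ w hne
    have h0 : Sum.elim ξ w ≠ 0 := by
      intro h0
      rcases hne with h1 | h1
      · exact h1 (funext fun i => congrFun h0 (.inl i))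
      · exact h1 (funext fun i => congrFun h0 (.inr i))
    have := PosDef.dotProduct_mulVec_pos h h0
    rw [star_trivial, neg_mulVec, dotProduct_neg, dissipationMatrix_form] at this
    linarith
  · intro h
    refine PosDef.of_dotProduct_mulVec_pos
      (dissipationMatrix_isSymm hQ hR hP A B C D).neg fun x hx => ?_
    have hx' : x = Sum.elim (x ∘ Sum.inl) (x ∘ Sum.inr) := by ext (i | i) <;> rfl
    rw [star_trivial, neg_mulVec, dotProduct_neg, hx', dissipationMatrix_form, neg_pos]
    refine h _ _ ?_
    by_contra! h0
    rw [hx', h0.1, h0.2] at hx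
    exact hx (by ext (i | i) <;> rfl)

/-- Elimination of the slack vectors: with `c = Δᵀ h` the robust form is a sum of squares minus the
left-hand side of the dissipation inequality and minus a multiple of the uncertainty bound. -/
lemma robustForm_eq [DecidableEq ι] (hRt : Rt.PosDef) (hT : s.R = T * Rt * Tᵀ) (hΛ : Λ.PosDef)
    (hP : P.IsSymm) (α : ℝ) (Δ : Matrix ν κ ℝ) (ξ : ι → ℝ) (w : Fin p → ℝ) (ρ : Fin qt → ℝ)
    (b : ι → ℝ) (e : Fin nt → ℝ) {h : ν → ℝ} (hh : h = L.Jᵀ *ᵥ P *ᵥ b) {y : ι → ℝ}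
    (hy : y = (L.A + L.J * Δ * L.G) *ᵥ ξ + (L.B + L.J * Δ * L.G') *ᵥ w) {z : Fin q → ℝ}
    (hz : z = L.C *ᵥ ξ + L.D *ᵥ w) :
    robustForm L s T Rt H N Ξ Λ P α ξ w ρ b (Δᵀ *ᵥ h) e
      = (b + y) ⬝ᵥ P *ᵥ (b + y)
        + (ρ + Rt *ᵥ Tᵀ *ᵥ z) ⬝ᵥ Rt⁻¹ *ᵥ (ρ + Rt *ᵥ Tᵀ *ᵥ z)
        + α * ((e + Λ *ᵥ Ξᵀ *ᵥ h) ⬝ᵥ Λ⁻¹ *ᵥ (e + Λ *ᵥ Ξᵀ *ᵥ h))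
        - α * uncertaintyForm (Ξ * Λ * Ξᵀ) H N h (Δᵀ *ᵥ h)
        - (y ⬝ᵥ P *ᵥ y - ξ ⬝ᵥ P *ᵥ ξ
          + (w ⬝ᵥ s.Q *ᵥ w + 2 * (w ⬝ᵥ s.S *ᵥ z) + z ⬝ᵥ s.R *ᵥ z)) := by
  have h1 : (Δᵀ *ᵥ h) ⬝ᵥ (L.G *ᵥ ξ + L.G' *ᵥ w)
      = (P *ᵥ b) ⬝ᵥ (L.J * Δ * L.G) *ᵥ ξ + (P *ᵥ b) ⬝ᵥ (L.J * Δ * L.G') *ᵥ w := by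
    rw [dotProduct_comm, dotProduct_transpose_mulVec_comm, hh, dotProduct_comm,
      dotProduct_transpose_mulVec_comm, dotProduct_comm]
    simp only [mulVec_add, dotProduct_add, mulVec_mulVec, Matrix.mul_assoc, dotProduct_comm]
  have h2 : (b + y) ⬝ᵥ P *ᵥ (b + y)
      = b ⬝ᵥ P *ᵥ b + 2 * ((P *ᵥ b) ⬝ᵥ y) + y ⬝ᵥ P *ᵥ y := by
    simp only [mulVec_add, add_dotProduct, dotProduct_add,
      dotProduct_mulVec_comm_of_isSymm hP b y, dotProduct_comm y]
    ring
  rw [h2, robustForm, ← hh, ← hz, slackSupply_eq hRt hT, multiplierForm_eq hΛ, h1, hy]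
  simp only [add_mulVec, dotProduct_add]
  ring

lemma isLinearMap_mulVec {E : Type*} [AddCommGroup E] [Module ℝ E] {k l : Type*} [Fintype k]
    (A : Matrix l k ℝ) {f : E → k → ℝ} (hf : IsLinearMap ℝ f) :
    IsLinearMap ℝ fun v => A *ᵥ f v :=
  ⟨fun x y => by simp only [hf.map_add, mulVec_add],
    fun c x => by simp only [hf.map_smul, mulVec_smul]⟩

lemma isLinearMap_add {E F : Type*} [AddCommGroup E] [Module ℝ E] [AddCommGroup F] [Module ℝ F]
    {f g : E → F} (hf : IsLinearMap ℝ f) (hg : IsLinearMap ℝ g) :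
    IsLinearMap ℝ fun v => f v + g v :=
  ⟨fun x y => by simp only [hf.map_add, hg.map_add]; abel,
    fun c x => by simp only [hf.map_smul, hg.map_smul, smul_add]⟩

section Regularity

variable {E : Type*} [NormedAddCommGroup E] [NormedSpace ℝ E] [FiniteDimensional ℝ E]

lemma isQuadratic_slackSupply {w : E → Fin p → ℝ} {ρ : E → Fin qt → ℝ} {z : E → Fin q → ℝ}
    (hw : IsLinearMap ℝ w) (hρ : IsLinearMap ℝ ρ) (hz : IsLinearMap ℝ z) :
    IsQuadratic fun v => slackSupply s T Rt (w v) (ρ v) (z v) := by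
  have h1 := (IsQuadratic.dotProduct hw (isLinearMap_mulVec s.S hz)).const_mul (-2)
  have h2 := (IsQuadratic.dotProduct hw (isLinearMap_mulVec s.Q hw)).const_mul (-1)
  have h3 := (IsQuadratic.dotProduct hρ (isLinearMap_mulVec Tᵀ hz)).const_mul 2
  have h4 := IsQuadratic.dotProduct hρ (isLinearMap_mulVec Rt⁻¹ hρ)
  convert ((h1.add h2).add h3).add h4 using 2
  rw [slackSupply]; ring

lemma isQuadratic_uncertaintyForm {Γ : Matrix ν ν ℝ} {h : E → ν → ℝ} {c : E → κ → ℝ}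
    (hh : IsLinearMap ℝ h) (hc : IsLinearMap ℝ c) :
    IsQuadratic fun v => uncertaintyForm Γ H N (h v) (c v) := by
  have h1 := IsQuadratic.dotProduct hh (isLinearMap_mulVec Γ hh)
  have h2 := (IsQuadratic.dotProduct hh (isLinearMap_mulVec H hc)).const_mul 2
  have h3 := (IsQuadratic.dotProduct hc (isLinearMap_mulVec N hc)).const_mul (-1)
  convert (h1.add h2).add h3 using 2
  rw [uncertaintyForm]; ring

lemma isQuadratic_multiplierForm {h : E → ν → ℝ} {c : E → κ → ℝ} {e : E → Fin nt → ℝ}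
    (hh : IsLinearMap ℝ h) (hc : IsLinearMap ℝ c) (he : IsLinearMap ℝ e) :
    IsQuadratic fun v => multiplierForm H N Ξ Λ (h v) (c v) (e v) := by
  have h1 := (IsQuadratic.dotProduct hh (isLinearMap_mulVec H hc)).const_mul (-2)
  have h2 := (IsQuadratic.dotProduct hh (isLinearMap_mulVec Ξ he)).const_mul 2
  have h3 := IsQuadratic.dotProduct hc (isLinearMap_mulVec N hc)
  have h4 := IsQuadratic.dotProduct he (isLinearMap_mulVec Λ⁻¹ he)
  exact ((h1.add h2).add h3).add h4

lemma isQuadratic_robustForm {α : ℝ} {ξ : E → ι → ℝ} {w : E → Fin p → ℝ} {ρ : E → Fin qt → ℝ}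
    {b : E → ι → ℝ} {c : E → κ → ℝ} {e : E → Fin nt → ℝ} (hξ : IsLinearMap ℝ ξ)
    (hw : IsLinearMap ℝ w) (hρ : IsLinearMap ℝ ρ) (hb : IsLinearMap ℝ b) (hc : IsLinearMap ℝ c)
    (he : IsLinearMap ℝ e) :
    IsQuadratic fun v =>
      robustForm L s T Rt H N Ξ Λ P α (ξ v) (w v) (ρ v) (b v) (c v) (e v) := by
  have h1 := IsQuadratic.dotProduct hξ (isLinearMap_mulVec P hξ)
  have h2 := isQuadratic_slackSupply (s := s) (T := T) (Rt := Rt) hw hρ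
    (isLinearMap_add (isLinearMap_mulVec L.C hξ) (isLinearMap_mulVec L.D hw))
  have h3 := (IsQuadratic.dotProduct (isLinearMap_mulVec P hb)
    (isLinearMap_add (isLinearMap_mulVec L.A hξ) (isLinearMap_mulVec L.B hw))).const_mul 2
  have h4 := IsQuadratic.dotProduct hb (isLinearMap_mulVec P hb)
  have h5 := (IsQuadratic.dotProduct hc
    (isLinearMap_add (isLinearMap_mulVec L.G hξ) (isLinearMap_mulVec L.G' hw))).const_mul 2
  have h6 := (isQuadratic_multiplierForm (H := H) (N := N) (Ξ := Ξ) (Λ := Λ)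
    (isLinearMap_mulVec L.Jᵀ (isLinearMap_mulVec P hb)) hc he).const_mul α
  exact ((((h1.add h2).add h3).add h4).add h5).add h6

/-- The robust form is affine in the storage matrix, so its positivity survives small changes of
that matrix. -/
lemma exists_robustForm_perturb {α : ℝ} (D : Matrix ι ι ℝ)
    (hpos : ∀ ξ w ρ b c e, (ξ, w, ρ, b, c, e) ≠ 0 →
      0 < robustForm L s T Rt H N Ξ Λ P α ξ w ρ b c e) :
    ∃ ε > 0, ∀ t : ℝ, |t| ≤ ε → ∀ ξ w ρ b c e, (ξ, w, ρ, b, c, e) ≠ 0 →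
      0 < robustForm L s T Rt H N Ξ Λ (P + t • D) α ξ w ρ b c e := by
  let E := (ι → ℝ) × (Fin p → ℝ) × (Fin qt → ℝ) × (ι → ℝ) × (κ → ℝ) × (Fin nt → ℝ)
  let F (P : Matrix ι ι ℝ) (v : E) : ℝ :=
    robustForm L s T Rt H N Ξ Λ P α v.1 v.2.1 v.2.2.1 v.2.2.2.1 v.2.2.2.2.1 v.2.2.2.2.2
  have hF : ∀ P, IsQuadratic (F P) := fun P =>
    isQuadratic_robustForm ⟨fun _ _ => rfl, fun _ _ => rfl⟩ ⟨fun _ _ => rfl, fun _ _ => rfl⟩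
      ⟨fun _ _ => rfl, fun _ _ => rfl⟩ ⟨fun _ _ => rfl, fun _ _ => rfl⟩
      ⟨fun _ _ => rfl, fun _ _ => rfl⟩ ⟨fun _ _ => rfl, fun _ _ => rfl⟩
  obtain ⟨ε, hε, h⟩ := (hF P).pos_add_mul ((hF (P + D)).add ((hF P).const_mul (-1)))
    fun v hv => hpos _ _ _ _ _ _ hv
  refine ⟨ε, hε, fun t ht ξ w ρ b c e hne => ?_⟩
  have h0 := h t ht (ξ, w, ρ, b, c, e) hne
  have haff : robustForm L s T Rt H N Ξ Λ (P + t • D) α ξ w ρ b c e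
      = F P (ξ, w, ρ, b, c, e) + t * (F (P + D) (ξ, w, ρ, b, c, e)
        + -1 * F P (ξ, w, ρ, b, c, e)) := by
    simp only [F, robustForm, multiplierForm, add_mulVec, smul_mulVec, mulVec_add, mulVec_smul,
      dotProduct_add, add_dotProduct, dotProduct_smul, smul_dotProduct, smul_eq_mul]
    ring
  rwa [haff]

end Regularity

lemma posDef_of_robustForm_pos {α : ℝ} (hP : P.IsSymm)
    (hpos : ∀ ξ w ρ b c e, (ξ, w, ρ, b, c, e) ≠ 0 →
      0 < robustForm L s T Rt H N Ξ Λ P α ξ w ρ b c e) : P.PosDef := by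
  refine PosDef.of_dotProduct_mulVec_pos hP fun ξ hξ => ?_
  have h := hpos ξ 0 0 0 0 0 (by simp [hξ])
  simp only [robustForm, slackSupply, multiplierForm, mulVec_zero, dotProduct_zero,
    zero_dotProduct, mul_zero, add_zero, sub_zero] at h
  simpa using h

/-- Robust dissipativity with the storage function `xᵀ P x` is equivalent to positivity of the
robust form for some multiplier: full-block S-procedure without constraint qualification. -/
theorem forall_strictlyDissipative_iff [DecidableEq ι] [DecidableEq κ] (hQ : s.Q.IsSymm)
    (hRt : Rt.PosDef) (hT : s.R = T * Rt * Tᵀ) (hΛ : Λ.PosDef) (hN : N.PosDef) (hP : P.PosDef) :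
    (∀ Δ : Matrix ν κ ℝ, (∀ v, 0 ≤ uncertaintyForm (Ξ * Λ * Ξᵀ) H N v (Δᵀ *ᵥ v)) →
      StrictlyDissipative s P (L.A + L.J * Δ * L.G) (L.B + L.J * Δ * L.G') L.C L.D) ↔
    ∃ α, ∀ ξ w ρ b c e, (ξ, w, ρ, b, c, e) ≠ 0 →
      0 < robustForm L s T Rt H N Ξ Λ P α ξ w ρ b c e := by
  have hPs : P.IsSymm := hP.isHermitian
  have hRs : s.R.IsSymm := by
    have : Rtᵀ = Rt := hRt.isHermitian
    rw [hT, IsSymm, transpose_mul, transpose_mul, transpose_transpose, this, Matrix.mul_assoc]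
  have hΓ : (Ξ * Λ * Ξᵀ).PosSemidef := hΛ.posSemidef.mul_mul_conjTranspose_same Ξ
  simp only [strictlyDissipative_iff hQ hRs hPs]
  constructor
  · intro hd
    let E := (ι → ℝ) × (Fin p → ℝ) × (Fin qt → ℝ) × (ι → ℝ) × (κ → ℝ)
    let ξ : E → ι → ℝ := fun v => v.1
    let w : E → Fin p → ℝ := fun v => v.2.1
    let ρ : E → Fin qt → ℝ := fun v => v.2.2.1
    let b : E → ι → ℝ := fun v => v.2.2.2.1
    let c : E → κ → ℝ := fun v => v.2.2.2.2
    have hξ : IsLinearMap ℝ ξ := ⟨fun _ _ => rfl, fun _ _ => rfl⟩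
    have hw : IsLinearMap ℝ w := ⟨fun _ _ => rfl, fun _ _ => rfl⟩
    have hρ : IsLinearMap ℝ ρ := ⟨fun _ _ => rfl, fun _ _ => rfl⟩
    have hb : IsLinearMap ℝ b := ⟨fun _ _ => rfl, fun _ _ => rfl⟩
    have hc : IsLinearMap ℝ c := ⟨fun _ _ => rfl, fun _ _ => rfl⟩
    let h : E → ν → ℝ := fun v => L.Jᵀ *ᵥ P *ᵥ b v
    have hh : IsLinearMap ℝ h := isLinearMap_mulVec _ (isLinearMap_mulVec _ hb)
    -- the robust form without multiplier and without the slack vector `e`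
    let f : E → ℝ := fun v => robustForm L s T Rt H N Ξ Λ P 0 (ξ v) (w v) (ρ v) (b v) (c v) 0
    let g : E → ℝ := fun v => -1 * uncertaintyForm (Ξ * Λ * Ξᵀ) H N (h v) (c v)
    have hf : IsQuadratic f :=
      isQuadratic_robustForm hξ hw hρ hb hc
        ⟨fun _ _ => (add_zero _).symm, fun _ _ => (smul_zero _).symm⟩
    have hg : IsQuadratic g := (isQuadratic_uncertaintyForm hh hc).const_mul _
    have hfg : ∀ v, v ≠ 0 → g v ≤ 0 → 0 < f v := by
      intro v hv hgv
      have hu : 0 ≤ uncertaintyForm (Ξ * Λ * Ξᵀ) H N (h v) (c v) := by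
        simp only [g] at hgv; linarith
      obtain ⟨Δ, hΔ, hΔ'⟩ := exists_uncertainty hΓ hN hu
      have hdΔ := hd Δ hΔ' (ξ v) (w v)
      have hfe := robustForm_eq (L := L) (H := H) (N := N) (Ξ := Ξ) hRt hT hΛ hPs 0 Δ (ξ v) (w v)
        (ρ v) (b v) 0 (h := h v) rfl rfl rfl
      rw [hΔ] at hfe
      simp only [zero_mul, add_zero, sub_zero] at hfe
      show 0 < robustForm L s T Rt H N Ξ Λ P 0 (ξ v) (w v) (ρ v) (b v) (c v) 0
      rw [hfe]
      have i1 := hP.posSemidef.dotProduct_mulVec_nonneg (b v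
        + ((L.A + L.J * Δ * L.G) *ᵥ ξ v + (L.B + L.J * Δ * L.G') *ᵥ w v))
      have i2 := hRt.inv.posSemidef.dotProduct_mulVec_nonneg
        (ρ v + Rt *ᵥ Tᵀ *ᵥ (L.C *ᵥ ξ v + L.D *ᵥ w v))
      rw [star_trivial] at i1 i2
      by_cases hξw : ξ v ≠ 0 ∨ w v ≠ 0
      · linarith [hdΔ hξw]
      · push Not at hξw
        obtain ⟨hξ0, hw0⟩ := hξw
        simp only [hξ0, hw0, mulVec_zero, add_zero, dotProduct_zero, mul_zero, sub_zero]
        by_cases hb0 : b v = 0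
        · have hc0 : c v = 0 := by
            rw [← hΔ]; simp only [h, hb0, mulVec_zero]
          have hρ0 : ρ v ≠ 0 := by
            intro hρ0
            exact hv (Prod.ext hξ0 (Prod.ext hw0 (Prod.ext hρ0 (Prod.ext hb0 hc0))))
          have := hRt.inv.dotProduct_mulVec_pos hρ0
          simpa [hb0] using this
        · have i3 := hP.dotProduct_mulVec_pos hb0
          have i4 := hRt.inv.posSemidef.dotProduct_mulVec_nonneg (ρ v)
          rw [star_trivial] at i3 i4
          linarith
    obtain ⟨α, hα, hpos⟩ := hf.exists_multiplier hg hfg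
    refine ⟨α, fun ξ' w' ρ' b' c' e' hne => ?_⟩
    have hsplit : robustForm L s T Rt H N Ξ Λ P α ξ' w' ρ' b' c' e'
        = f (ξ', w', ρ', b', c') + α * g (ξ', w', ρ', b', c')
          + α * ((e' + Λ *ᵥ Ξᵀ *ᵥ L.Jᵀ *ᵥ P *ᵥ b') ⬝ᵥ
            Λ⁻¹ *ᵥ (e' + Λ *ᵥ Ξᵀ *ᵥ L.Jᵀ *ᵥ P *ᵥ b')) := by
      simp only [f, g, robustForm, multiplierForm_eq hΛ, ξ, w, ρ, b, c, h]
      ring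
    rw [hsplit]
    by_cases h0 : ((ξ', w', ρ', b', c') : E) = 0
    · have he : e' ≠ 0 := by
        rintro rfl
        simp only [Prod.mk_eq_zero] at h0
        obtain ⟨rfl, rfl, rfl, rfl, rfl⟩ := h0
        exact hne rfl
      have hb0 : b' = 0 := by
        simp only [Prod.mk_eq_zero] at h0; exact h0.2.2.2.1
      rw [h0, hf.map_zero, hg.map_zero, hb0]
      have := mul_pos hα (hΛ.inv.dotProduct_mulVec_pos he)
      simpa using this
    · have := mul_nonneg hα.le (hΛ.inv.posSemidef.dotProduct_mulVec_nonneg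
        (e' + Λ *ᵥ Ξᵀ *ᵥ L.Jᵀ *ᵥ P *ᵥ b'))
      rw [star_trivial] at this
      linarith [hpos _ h0]
  · rintro ⟨α, hpos⟩ Δ hΔ ξ w hne
    have h0 : ∀ v, 0 ≤ α * uncertaintyForm (Ξ * Λ * Ξᵀ) H N v (Δᵀ *ᵥ v) := by
      intro v
      by_cases hα : 0 ≤ α
      · exact mul_nonneg hα (hΔ v)
      -- a negative multiplier is only possible if the vectors `c` and `e` have no entries
      · have hc : ∀ c : κ → ℝ, c = 0 := by
          intro c
          by_contra hc
          have h1 := hpos 0 0 0 0 c 0 (by simp [hc])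
          simp only [robustForm, slackSupply, multiplierForm, mulVec_zero, dotProduct_zero,
            zero_dotProduct, mul_zero, add_zero, zero_add, sub_zero] at h1
          have h2 := hN.dotProduct_mulVec_pos hc
          rw [star_trivial] at h2
          nlinarith
        have he : ∀ e : Fin nt → ℝ, e = 0 := by
          intro e
          by_contra he
          have h1 := hpos 0 0 0 0 0 e (by simp [he])
          simp only [robustForm, slackSupply, multiplierForm, mulVec_zero, dotProduct_zero,
            zero_dotProduct, mul_zero, add_zero, zero_add, sub_zero] at h1
          have h2 := hΛ.inv.dotProduct_mulVec_pos he
          rw [star_trivial] at h2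
          nlinarith
        simp [uncertaintyForm, hc (Δᵀ *ᵥ v), ← mulVec_mulVec, he (Ξᵀ *ᵥ v)]
    set y := (L.A + L.J * Δ * L.G) *ᵥ ξ + (L.B + L.J * Δ * L.G') *ᵥ w with hy
    set z := L.C *ᵥ ξ + L.D *ᵥ w with hz
    -- the minimizers of the squares in `robustForm_eq`
    have h1 := hpos ξ w (-(Rt *ᵥ Tᵀ *ᵥ z)) (-y) (Δᵀ *ᵥ L.Jᵀ *ᵥ P *ᵥ (-y))
      (-(Λ *ᵥ Ξᵀ *ᵥ L.Jᵀ *ᵥ P *ᵥ (-y))) (by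
        simp only [ne_eq, Prod.mk_eq_zero]
        tauto)
    rw [robustForm_eq hRt hT hΛ hPs α Δ ξ w _ _ _ rfl hy hz] at h1
    simp only [neg_add_cancel, mulVec_zero, dotProduct_zero, mul_zero, zero_add] at h1
    linarith [h0 (L.Jᵀ *ᵥ P *ᵥ (-y))]

end RobustForm

/-! ### The systems consistent with the data -/

section ConsistentSystems

variable {n m p q l N nt : ℕ} {M : KnownModel n m p q l} {r : Recording n m N} {b : NoiseBound p N}

/-- A matrix whose transpose vanishes on the kernel of `Bᵀ` factors through `B`. -/
lemma exists_eq_mul_of_ker_le {k l j : Type*} [Fintype k] [Fintype l] (B : Matrix k l ℝ)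
    (D : Matrix k j ℝ) (h : ∀ v, Bᵀ *ᵥ v = 0 → Dᵀ *ᵥ v = 0) : ∃ W : Matrix l j ℝ, D = B * W := by
  have hcol : ∀ a : j, ∃ x : l → ℝ, D.col a = B *ᵥ x := by
    intro a
    let F (x : k → ℝ) : (k → ℝ) →ₗ[ℝ] ℝ := dotProductBilin ℝ ℝ x
    have hmem : F (D.col a) ∈ Submodule.span ℝ (Set.range fun i => F (B.col i)) := by
      refine mem_span_of_iInf_ker_le_ker fun v hv => ?_
      simp only [Submodule.mem_iInf, LinearMap.mem_ker] at hv ⊢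
      exact congrFun (h v (funext hv)) a
    obtain ⟨x, hx⟩ := (Submodule.mem_span_range_iff_exists_fun ℝ).1 hmem
    refine ⟨x, ?_⟩
    classical
    ext i
    have := LinearMap.congr_fun hx (Pi.single i 1)
    simp only [LinearMap.sum_apply, LinearMap.smul_apply] at this
    simp [F] at this
    rw [col_apply, ← this, mulVec, dotProduct]
    exact Finset.sum_congr rfl fun c _ => mul_comm _ _
  choose W hW using hcol
  refine ⟨of fun i a => W a i, ?_⟩
  ext i a
  exact congrFun (hW a) i

lemma dataMatrix_mulVec (v a : Fin n → ℝ) (c : Fin m → ℝ) :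
    dataMatrix r *ᵥ Sum.elim v (Sum.elim a c)
      = Sum.elim v (r.Xplusᵀ *ᵥ v - r.Xminusᵀ *ᵥ a - r.Uminusᵀ *ᵥ c) := by
  simp only [dataMatrix, fromRows_mulVec, fromCols_mulVec_sumElim, one_mulVec, zero_mulVec,
    neg_mulVec, add_zero, add_assoc, sub_eq_add_neg]

/-- The form of `Φ̃` is the form of `Φ` at the residual of the data equation. -/
lemma PhiT_form (v a : Fin n → ℝ) (c : Fin m → ℝ) :
    Sum.elim v (Sum.elim a c) ⬝ᵥ PhiT M r b *ᵥ Sum.elim v (Sum.elim a c)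
      = Sum.elim v (r.Xplusᵀ *ᵥ v - r.Xminusᵀ *ᵥ a - r.Uminusᵀ *ᵥ c) ⬝ᵥ noiseMatrix M b *ᵥ
        Sum.elim v (r.Xplusᵀ *ᵥ v - r.Xminusᵀ *ᵥ a - r.Uminusᵀ *ᵥ c) := by
  rw [PhiT, Matrix.mul_assoc, ← mulVec_mulVec, dotProduct_transpose_mulVec_comm, ← mulVec_mulVec,
    dataMatrix_mulVec, dotProduct_comm]

lemma PhiT_isSymm (hΦ : (noiseMatrix M b).IsSymm) : (PhiT M r b).IsSymm := by
  rw [PhiT, IsSymm, transpose_mul, transpose_mul, transpose_transpose, hΦ.eq, Matrix.mul_assoc]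

lemma noiseAdmissible_iff (hΦ : (noiseMatrix M b).IsSymm) (W : Matrix (Fin p) (Fin N) ℝ) :
    NoiseAdmissible M b W ↔ ∀ v, 0 ≤ Sum.elim v ((M.B₁ * W)ᵀ *ᵥ v) ⬝ᵥ noiseMatrix M b *ᵥ
      Sum.elim v ((M.B₁ * W)ᵀ *ᵥ v) := by
  set G : Matrix (Fin n ⊕ Fin N) (Fin n) ℝ :=
    (1 : Matrix (Fin n) (Fin n) ℝ) ⬓ Wᵀ * M.B₁ᵀ with hG
  have hGv : ∀ v, G *ᵥ v = Sum.elim v ((M.B₁ * W)ᵀ *ᵥ v) := fun v => by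
    rw [hG, fromRows_mulVec, one_mulVec, transpose_mul]
  have hform : ∀ v, v ⬝ᵥ (Gᵀ * noiseMatrix M b * G) *ᵥ v
      = Sum.elim v ((M.B₁ * W)ᵀ *ᵥ v) ⬝ᵥ noiseMatrix M b *ᵥ Sum.elim v ((M.B₁ * W)ᵀ *ᵥ v) := by
    intro v
    rw [Matrix.mul_assoc, ← mulVec_mulVec, dotProduct_transpose_mulVec_comm, ← mulVec_mulVec, hGv,
      dotProduct_comm]
  have hsymm : (Gᵀ * noiseMatrix M b * G).IsSymm := by
    rw [IsSymm, transpose_mul, transpose_mul, transpose_transpose, hΦ.eq, Matrix.mul_assoc]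
  constructor
  · intro h v
    have := PosSemidef.dotProduct_mulVec_nonneg h v
    rwa [star_trivial, hform] at this
  · intro h
    refine PosSemidef.of_dotProduct_mulVec_nonneg hsymm fun v => ?_
    rw [star_trivial, hform]
    exact h v

/-- The consistent systems are described by a quadratic inequality alone: as `Φ₂₂ ≺ 0`, the
inequality forces the residual of the data equation into the range of `B₁`. -/
lemma mem_consistentSystems_iff (hΦ : (noiseMatrix M b).IsSymm) (hΦ₂₂ : (-b.Φ₂₂).PosDef)
    (A : Matrix (Fin n) (Fin n) ℝ) (B : Matrix (Fin n) (Fin m) ℝ) :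
    (A, B) ∈ consistentSystems M r b ↔ ∀ v, 0 ≤ Sum.elim v (Sum.elim (Aᵀ *ᵥ v) (Bᵀ *ᵥ v)) ⬝ᵥ
      PhiT M r b *ᵥ Sum.elim v (Sum.elim (Aᵀ *ᵥ v) (Bᵀ *ᵥ v)) := by
  have hres : ∀ v, r.Xplusᵀ *ᵥ v - r.Xminusᵀ *ᵥ Aᵀ *ᵥ v - r.Uminusᵀ *ᵥ Bᵀ *ᵥ v
      = (r.Xplus - A * r.Xminus - B * r.Uminus)ᵀ *ᵥ v := fun v => by
    simp only [transpose_sub, transpose_mul, sub_mulVec, mulVec_mulVec]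
  simp only [PhiT_form, hres]
  constructor
  · rintro ⟨W, hW, heq⟩ v
    have : r.Xplus - A * r.Xminus - B * r.Uminus = M.B₁ * W := by
      rw [heq]; abel
    rw [this]
    exact (noiseAdmissible_iff hΦ W).1 hW v
  · intro h
    obtain ⟨W, hW⟩ := exists_eq_mul_of_ker_le M.B₁ (r.Xplus - A * r.Xminus - B * r.Uminus) (by
      intro v hv
      by_contra hne
      have h1 := h v
      have h2 := hΦ₂₂.dotProduct_mulVec_pos hne
      simp only [noiseMatrix, fromBlocks_mulVec, Sum.elim_comp_inl, Sum.elim_comp_inr,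
        sumElim_dotProduct_sumElim, ← mulVec_mulVec, hv, mulVec_zero, zero_add] at h1
      rw [dotProduct_mulVec v M.B₁, ← mulVec_transpose, hv, zero_dotProduct] at h1
      rw [star_trivial, neg_mulVec, dotProduct_neg] at h2
      linarith)
    refine ⟨W, (noiseAdmissible_iff hΦ W).2 fun v => ?_, ?_⟩
    · rw [← hW]; exact h v
    · rw [← hW]; abel

variable (M r b) in
/-- The matrix `(H₂ H₃)` of the cross term of the uncertainty bound around `(As, Bs)`. -/
def crossTerm (As : Matrix (Fin n) (Fin n) ℝ) (Bs : Matrix (Fin n) (Fin m) ℝ) :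
    Matrix (Fin n) (Fin n ⊕ Fin m) ℝ :=
  (PhiT₁₂ M r b + As * PhiT₂₂ M r b + Bs * (PhiT₂₃ M r b)ᵀ) ◨
    (PhiT₁₃ M r b + As * PhiT₂₃ M r b + Bs * PhiT₃₃ M r b)

lemma PhiT_toBlocks₂₂ (hΦ : (noiseMatrix M b).IsSymm) :
    (PhiT M r b).toBlocks₂₂
      = fromBlocks (PhiT₂₂ M r b) (PhiT₂₃ M r b) (PhiT₂₃ M r b)ᵀ (PhiT₃₃ M r b) := by
  ext (i | i) (j | j)
  · rfl
  · rfl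
  · exact (PhiT_isSymm hΦ).apply _ _
  · rfl

lemma PhiT_mulVec_inr (hΦ : (noiseMatrix M b).IsSymm) (As : Matrix (Fin n) (Fin n) ℝ)
    (Bs : Matrix (Fin n) (Fin m) ℝ) (c : Fin n ⊕ Fin m → ℝ) :
    ((1 : Matrix (Fin n) (Fin n) ℝ) ◨ As ◨ Bs) *ᵥ PhiT M r b *ᵥ Sum.elim 0 c
      = crossTerm M r b As Bs *ᵥ c := by
  have h12 : (PhiT M r b).toBlocks₁₂ = PhiT₁₂ M r b ◨ PhiT₁₃ M r b :=
    (fromCols_toCols _).symm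
  have hc : c = Sum.elim (c ∘ Sum.inl) (c ∘ Sum.inr) := by ext (i | i) <;> rfl
  rw [← fromBlocks_toBlocks (PhiT M r b), PhiT_toBlocks₂₂ hΦ, h12, hc]
  simp only [fromBlocks_mulVec, Sum.elim_comp_inl, Sum.elim_comp_inr, mulVec_zero, zero_add,
    fromCols_mulVec_sumElim, crossTerm, add_mulVec, mulVec_add, mulVec_mulVec, Matrix.one_mul]
  abel

/-- The form of `Φ̃` around the system `(As, Bs)`. -/
lemma PhiT_form_shift (hΦ : (noiseMatrix M b).IsSymm) {As : Matrix (Fin n) (Fin n) ℝ}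
    {Bs : Matrix (Fin n) (Fin m) ℝ} {Ξ : Matrix (Fin n) (Fin nt) ℝ}
    {Λ : Matrix (Fin nt) (Fin nt) ℝ}
    (hΞ : ((1 : Matrix (Fin n) (Fin n) ℝ) ◨ As ◨ Bs) * PhiT M r b
      * ((1 : Matrix (Fin n) (Fin n) ℝ) ◨ As ◨ Bs)ᵀ = Ξ * Λ * Ξᵀ)
    (v : Fin n → ℝ) (c : Fin n ⊕ Fin m → ℝ) :
    Sum.elim v (Sum.elim (Asᵀ *ᵥ v) (Bsᵀ *ᵥ v) + c) ⬝ᵥ PhiT M r b *ᵥ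
        Sum.elim v (Sum.elim (Asᵀ *ᵥ v) (Bsᵀ *ᵥ v) + c)
      = uncertaintyForm (Ξ * Λ * Ξᵀ) (crossTerm M r b As Bs) (-(PhiT M r b).toBlocks₂₂) v c := by
  set G : Matrix (Fin n) (Fin n ⊕ Fin n ⊕ Fin m) ℝ := 1 ◨ As ◨ Bs with hG
  have hx : Sum.elim v (Sum.elim (Asᵀ *ᵥ v) (Bsᵀ *ᵥ v) + c) =
      Gᵀ *ᵥ v + Sum.elim (0 : Fin n → ℝ) c := by
    rw [hG, transpose_fromCols, transpose_fromCols, fromRows_mulVec, fromRows_mulVec,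
      transpose_one, one_mulVec]
    ext (i | i) <;> simp
  have h1 : (Gᵀ *ᵥ v) ⬝ᵥ PhiT M r b *ᵥ Gᵀ *ᵥ v = v ⬝ᵥ (Ξ * Λ * Ξᵀ) *ᵥ v := by
    rw [dotProduct_comm, dotProduct_transpose_mulVec_comm, ← hΞ, ← mulVec_mulVec, ← mulVec_mulVec]
  have h2 : (Gᵀ *ᵥ v) ⬝ᵥ PhiT M r b *ᵥ Sum.elim 0 c = v ⬝ᵥ crossTerm M r b As Bs *ᵥ c := by
    rw [dotProduct_comm, dotProduct_transpose_mulVec_comm, PhiT_mulVec_inr hΦ]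
  have h3 : Sum.elim 0 c ⬝ᵥ PhiT M r b *ᵥ Sum.elim 0 c = c ⬝ᵥ (PhiT M r b).toBlocks₂₂ *ᵥ c := by
    conv_lhs => rw [← fromBlocks_toBlocks (PhiT M r b)]
    simp only [fromBlocks_mulVec, Sum.elim_comp_inl, Sum.elim_comp_inr, mulVec_zero, zero_add,
      sumElim_dotProduct_sumElim, zero_dotProduct]
  rw [hx, uncertaintyForm, mulVec_add, add_dotProduct, dotProduct_add, dotProduct_add, h1, h2, h3,
    dotProduct_mulVec_comm_of_isSymm (PhiT_isSymm hΦ), h2, neg_mulVec, dotProduct_neg]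
  ring

lemma mem_consistentSystems_add_iff (hΦ : (noiseMatrix M b).IsSymm) (hΦ₂₂ : (-b.Φ₂₂).PosDef)
    {As : Matrix (Fin n) (Fin n) ℝ} {Bs : Matrix (Fin n) (Fin m) ℝ} {Ξ : Matrix (Fin n) (Fin nt) ℝ}
    {Λ : Matrix (Fin nt) (Fin nt) ℝ}
    (hΞ : ((1 : Matrix (Fin n) (Fin n) ℝ) ◨ As ◨ Bs) * PhiT M r b
      * ((1 : Matrix (Fin n) (Fin n) ℝ) ◨ As ◨ Bs)ᵀ = Ξ * Λ * Ξᵀ)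
    (Δ₁ : Matrix (Fin n) (Fin n) ℝ) (Δ₂ : Matrix (Fin n) (Fin m) ℝ) :
    (As + Δ₁, Bs + Δ₂) ∈ consistentSystems M r b ↔
      ∀ v, 0 ≤ uncertaintyForm (Ξ * Λ * Ξᵀ) (crossTerm M r b As Bs) (-(PhiT M r b).toBlocks₂₂) v
        ((Δ₁ ◨ Δ₂)ᵀ *ᵥ v) := by
  rw [mem_consistentSystems_iff hΦ hΦ₂₂]
  refine forall_congr' fun v => ?_
  rw [← PhiT_form_shift hΦ hΞ, transpose_fromCols, fromRows_mulVec, transpose_add, transpose_add,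
    add_mulVec, add_mulVec]
  have : Sum.elim (Asᵀ *ᵥ v + Δ₁ᵀ *ᵥ v) (Bsᵀ *ᵥ v + Δ₂ᵀ *ᵥ v)
      = Sum.elim (Asᵀ *ᵥ v) (Bsᵀ *ᵥ v) + Sum.elim (Δ₁ᵀ *ᵥ v) (Δ₂ᵀ *ᵥ v) := by
    ext (i | i) <;> rfl
  rw [this]

/-- The data are rich enough for the set of consistent systems to be bounded. -/
lemma neg_PhiT_toBlocks₂₂_posDef (hΦ : (noiseMatrix M b).IsSymm) (hΦ₂₂ : (-b.Φ₂₂).PosDef)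
    (hrank : (r.Xminus ⬓ r.Uminus).rank = n + m) : (-(PhiT M r b).toBlocks₂₂).PosDef := by
  have hinj : ∀ c : Fin n ⊕ Fin m → ℝ, (r.Xminus ⬓ r.Uminus)ᵀ *ᵥ c = 0 → c = 0 := by
    have hli : LinearIndependent ℝ (r.Xminus ⬓ r.Uminus).row := by
      rw [linearIndependent_iff_card_eq_finrank_span, Set.finrank, ← rank_eq_finrank_span_row, hrank]
      simp
    intro c hc
    rw [mulVec_transpose] at hc
    exact (vecMul_injective_iff.2 hli) (by simpa using hc)
  refine PosDef.of_dotProduct_mulVec_pos ?_ fun c hc => ?_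
  · have hs := PhiT_isSymm (r := r) hΦ
    refine IsHermitian.neg (ext fun i j => ?_)
    exact hs.apply (Sum.inr i) (Sum.inr j)
  · have hc' : c = Sum.elim (c ∘ Sum.inl) (c ∘ Sum.inr) := by ext (i | i) <;> rfl
    have hne : -((r.Xminus ⬓ r.Uminus)ᵀ *ᵥ c) ≠ 0 := fun h => hc (hinj c (neg_eq_zero.1 h))
    have h1 : c ⬝ᵥ (PhiT M r b).toBlocks₂₂ *ᵥ c
        = Sum.elim 0 c ⬝ᵥ PhiT M r b *ᵥ Sum.elim 0 c := by
      conv_rhs => rw [← fromBlocks_toBlocks (PhiT M r b)]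
      simp only [fromBlocks_mulVec, Sum.elim_comp_inl, Sum.elim_comp_inr, mulVec_zero, zero_add,
        sumElim_dotProduct_sumElim, zero_dotProduct]
    have h2 : -((r.Xminus ⬓ r.Uminus)ᵀ *ᵥ c) = r.Xplusᵀ *ᵥ 0 - r.Xminusᵀ *ᵥ (c ∘ Sum.inl)
        - r.Uminusᵀ *ᵥ (c ∘ Sum.inr) := by
      rw [transpose_fromRows, fromCols_mulVec, mulVec_zero]
      abel
    have h3 := hΦ₂₂.dotProduct_mulVec_pos hne
    rw [star_trivial] at h3 ⊢
    rw [neg_mulVec, dotProduct_neg, h1, hc', PhiT_form, ← h2, noiseMatrix]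
    rw [neg_mulVec, dotProduct_neg] at h3
    simpa only [fromBlocks_mulVec, Sum.elim_comp_inl, Sum.elim_comp_inr, mulVec_zero, zero_add,
      sumElim_dotProduct_sumElim, zero_dotProduct] using h3

/-- The closed loop as an uncertain system around its nominal value at `(As, Bs)`. -/
def closedLoop (M : KnownModel n m p q l) (K : Controller n m l) (As : Matrix (Fin n) (Fin n) ℝ)
    (Bs : Matrix (Fin n) (Fin m) ℝ) :
    UncertainLoop (Fin n ⊕ Fin n) (Fin n) (Fin n ⊕ Fin m) p q where
  A := clA M K As Bs
  B := clB M K Bs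
  C := clC M K
  D := clD M K
  J := 1 ⬓ 0
  G := fromBlocks 1 0 (K.Dc * M.C) K.Cc
  G' := 0 ⬓ (K.Dc * M.F)

lemma clA_add (K : Controller n m l) (As Δ₁ : Matrix (Fin n) (Fin n) ℝ)
    (Bs Δ₂ : Matrix (Fin n) (Fin m) ℝ) :
    clA M K (As + Δ₁) (Bs + Δ₂) = (closedLoop M K As Bs).A
      + (closedLoop M K As Bs).J * (Δ₁ ◨ Δ₂) * (closedLoop M K As Bs).G := by
  simp only [closedLoop, clA, fromRows_mul, fromCols_mul_fromBlocks, Matrix.one_mul,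
    Matrix.zero_mul, Matrix.mul_one, Matrix.mul_zero, zero_add, Matrix.add_mul, Matrix.mul_assoc]
  ext (i | i) (j | j) <;> simp [add_add_add_comm]

lemma clB_add (K : Controller n m l) (As Δ₁ : Matrix (Fin n) (Fin n) ℝ)
    (Bs Δ₂ : Matrix (Fin n) (Fin m) ℝ) :
    clB M K (Bs + Δ₂) = (closedLoop M K As Bs).B
      + (closedLoop M K As Bs).J * (Δ₁ ◨ Δ₂) * (closedLoop M K As Bs).G' := by
  simp only [closedLoop, clB, fromRows_mul, fromCols_mul_fromRows, Matrix.one_mul,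
    Matrix.zero_mul, Matrix.mul_zero, zero_add, Matrix.add_mul, Matrix.mul_assoc]
  ext (i | i) j <;> simp [add_assoc]

/-- Robust dissipativity of a given controller as positivity of a single quadratic form. -/
theorem robustlyDissipative_iff {qt : ℕ} {s : Supply p q} (hΦ : (noiseMatrix M b).IsSymm)
    (hΦ₂₂ : (-b.Φ₂₂).PosDef) (hrank : (r.Xminus ⬓ r.Uminus).rank = n + m) (hQ : s.Q.IsSymm)
    {As : Matrix (Fin n) (Fin n) ℝ} {Bs : Matrix (Fin n) (Fin m) ℝ}
    {Ξ : Matrix (Fin n) (Fin nt) ℝ} {Λ : Matrix (Fin nt) (Fin nt) ℝ} (hΛ : Λ.PosDef)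
    (hΞ : ((1 : Matrix (Fin n) (Fin n) ℝ) ◨ As ◨ Bs) * PhiT M r b
      * ((1 : Matrix (Fin n) (Fin n) ℝ) ◨ As ◨ Bs)ᵀ = Ξ * Λ * Ξᵀ)
    {T : Matrix (Fin q) (Fin qt) ℝ} {Rt : Matrix (Fin qt) (Fin qt) ℝ} (hRt : Rt.PosDef)
    (hT : s.R = T * Rt * Tᵀ) (K : Controller n m l) :
    RobustlyDissipative M r b s K ↔
      ∃ P : Matrix (Fin n ⊕ Fin n) (Fin n ⊕ Fin n) ℝ, P.PosDef ∧ ∃ α : ℝ,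
        ∀ ξ w ρ y c e, (ξ, w, ρ, y, c, e) ≠ 0 →
          0 < robustForm (closedLoop M K As Bs) s T Rt (crossTerm M r b As Bs)
            (-(PhiT M r b).toBlocks₂₂) Ξ Λ P α ξ w ρ y c e := by
  refine exists_congr fun P => and_congr_right fun hP => ?_
  rw [← forall_strictlyDissipative_iff hQ hRt hT hΛ (neg_PhiT_toBlocks₂₂_posDef hΦ hΦ₂₂ hrank) hP]
  constructor
  · intro h Δ hΔ
    rw [← fromCols_toCols Δ] at hΔ
    have := h _ _ ((mem_consistentSystems_add_iff hΦ hΦ₂₂ hΞ _ _).2 hΔ)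
    rw [clA_add, clB_add K As Δ.toCols₁, fromCols_toCols] at this
    exact this
  · intro h A B hAB
    have hA : A = As + (A - As) := by abel
    have hB : B = Bs + (B - Bs) := by abel
    rw [hA, hB] at hAB ⊢
    rw [clA_add, clB_add K As (A - As)]
    exact h _ ((mem_consistentSystems_add_iff hΦ hΦ₂₂ hΞ _ _).1 hAB)

end ConsistentSystems

/-! ### The synthesis inequality -/

section Synthesis

variable {n m p q l N nt qt : ℕ} {M : KnownModel n m p q l} {r : Recording n m N}
  {b : NoiseBound p N} {s : Supply p q}
  {As : Matrix (Fin n) (Fin n) ℝ} {Bs : Matrix (Fin n) (Fin m) ℝ}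
  {Ξ : Matrix (Fin n) (Fin nt) ℝ} {Λ : Matrix (Fin nt) (Fin nt) ℝ}
  {T : Matrix (Fin q) (Fin qt) ℝ} {Rt : Matrix (Fin qt) (Fin qt) ℝ}
  {d : Decision n m l}

variable (M r b s As Bs Ξ Λ T Rt d) in
/-- The quadratic form of `Π` in terms of the signals that its rows define. -/
noncomputable def synthesisForm (x₁ x₂ : Fin n → ℝ) (w : Fin p → ℝ) (ρ : Fin qt → ℝ)
    (b₁ b₂ : Fin n → ℝ) (c : Fin n ⊕ Fin m → ℝ) (e : Fin nt → ℝ) : ℝ :=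
  x₁ ⬝ᵥ d.X *ᵥ x₁ + 2 * (x₁ ⬝ᵥ x₂) + x₂ ⬝ᵥ d.Y *ᵥ x₂
    + slackSupply s T Rt w ρ ((M.C₁ + M.E * d.Dc * M.C) *ᵥ x₁ + (M.C₁ * d.Y + M.E * d.Ct) *ᵥ x₂
      + (M.D₁ + M.E * d.Dc * M.F) *ᵥ w)
    + 2 * (b₁ ⬝ᵥ ((As + Bs * d.Dc * M.C) *ᵥ x₁ + (As * d.Y + Bs * d.Ct) *ᵥ x₂
      + (M.B₁ + Bs * d.Dc * M.F) *ᵥ w))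
    + 2 * (b₂ ⬝ᵥ ((d.X * As + d.Bt * M.C) *ᵥ x₁ + d.At *ᵥ x₂ + (d.X * M.B₁ + d.Bt * M.F) *ᵥ w))
    + (b₁ ⬝ᵥ d.Y *ᵥ b₁ + 2 * (b₁ ⬝ᵥ b₂) + b₂ ⬝ᵥ d.X *ᵥ b₂)
    + 2 * (c ⬝ᵥ Sum.elim (x₁ + d.Y *ᵥ x₂)
      ((d.Dc * M.C) *ᵥ x₁ + d.Ct *ᵥ x₂ + (d.Dc * M.F) *ᵥ w))
    + d.α * multiplierForm (crossTerm M r b As Bs) (-(PhiT M r b).toBlocks₂₂) Ξ Λ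
      (b₁ + d.X *ᵥ b₂) c e

lemma PiMatrix_form (hΦ : (noiseMatrix M b).IsSymm) (hX : d.X.IsSymm)
    (x₁ x₂ : Fin n → ℝ) (w : Fin p → ℝ) (ρ : Fin qt → ℝ)
    (b₁ b₂ c₁ : Fin n → ℝ) (c₂ : Fin m → ℝ) (e : Fin nt → ℝ) :
    Sum.elim (Sum.elim x₁ (Sum.elim x₂ (Sum.elim w ρ)))
        (Sum.elim b₁ (Sum.elim b₂ (Sum.elim c₁ (Sum.elim c₂ e)))) ⬝ᵥ
      PiMatrix M r b s As Bs Ξ Λ T Rt d *ᵥ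
        Sum.elim (Sum.elim x₁ (Sum.elim x₂ (Sum.elim w ρ)))
          (Sum.elim b₁ (Sum.elim b₂ (Sum.elim c₁ (Sum.elim c₂ e))))
      = synthesisForm M r b s As Bs Ξ Λ T Rt d x₁ x₂ w ρ b₁ b₂ (Sum.elim c₁ c₂) e := by
  have hXd : ∀ y, (d.X *ᵥ b₂) ⬝ᵥ y = b₂ ⬝ᵥ d.X *ᵥ y := fun y => by
    rw [dotProduct_comm, dotProduct_mulVec_comm_of_isSymm hX]
  simp only [PiMatrix, fromBlocks_mulVec, Sum.elim_comp_inl, Sum.elim_comp_inr,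
    sumElim_dotProduct_sumElim, dotProduct_add]
  rw [dotProduct_transpose_mulVec_comm]
  simp only [Pi₁₁, Pi₁₂T, Pi₂₂, fromRows_mulVec, fromCols_mulVec_sumElim,
    sumElim_dotProduct_sumElim, one_mulVec, zero_mulVec, dotProduct_add, dotProduct_zero,
    dotProduct_transpose_mulVec_comm, neg_mulVec, dotProduct_neg, neg_smul, smul_mulVec,
    dotProduct_smul, smul_eq_mul, sub_mulVec, dotProduct_sub, add_mulVec]
  simp only [synthesisForm, slackSupply, multiplierForm, PhiT_toBlocks₂₂ hΦ, crossTerm,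
    fromCols_mulVec_sumElim, fromBlocks_mulVec, Sum.elim_comp_inl, Sum.elim_comp_inr,
    sumElim_dotProduct_sumElim, neg_mulVec, dotProduct_neg, mulVec_add, dotProduct_add,
    dotProduct_transpose_mulVec_comm, add_mulVec, add_dotProduct, hXd, ← mulVec_mulVec]
  simp only [dotProduct_comm x₂ x₁, dotProduct_comm b₂ b₁]
  ring

lemma PiMatrix_isSymm (hΦ : (noiseMatrix M b).IsSymm) (hQ : s.Q.IsSymm) (hΛ : Λ.IsSymm)
    (hRt : Rt.IsSymm) (hX : d.X.IsSymm) (hY : d.Y.IsSymm) :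
    (PiMatrix M r b s As Bs Ξ Λ T Rt d).IsSymm := by
  have h22 : (PhiT₂₂ M r b).IsSymm := ext fun i j => (PhiT_isSymm hΦ).apply _ _
  have h33 : (PhiT₃₃ M r b).IsSymm := ext fun i j => (PhiT_isSymm hΦ).apply _ _
  have hΛi : (Λ⁻¹)ᵀ = Λ⁻¹ := by rw [transpose_nonsing_inv, hΛ.eq]
  have hRi : (Rt⁻¹)ᵀ = Rt⁻¹ := by rw [transpose_nonsing_inv, hRt.eq]
  have hone : ∀ i j : Fin n,
      (1 : Matrix (Fin n) (Fin n) ℝ) j i = (1 : Matrix (Fin n) (Fin n) ℝ) i j := fun i j => isSymm_one.apply i j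
  have h11 : (Pi₁₁ M s T Rt d).IsSymm := by
    have hq : (-s.Q - ((s.S * (M.D₁ + M.E * d.Dc * M.F))ᵀ
        + s.S * (M.D₁ + M.E * d.Dc * M.F))).IsSymm := by
      rw [IsSymm, transpose_sub, transpose_neg, hQ.eq, transpose_add, transpose_transpose,
        add_comm (s.S * _)]
    refine ext fun i j => ?_
    rcases i with i | i | i | i <;> rcases j with j | j | j | j
    exacts [hX.apply i j, hone i j, rfl, rfl, hone i j, hY.apply i j, rfl, rfl,
      rfl, rfl, hq.apply i j, rfl, rfl, rfl, rfl, IsSymm.apply hRi i j]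
  have h2 : (Pi₂₂ M r b As Bs Ξ Λ d).IsSymm := by
    refine ext fun i j => ?_
    rcases i with i | i | i | i | i <;> rcases j with j | j | j | j | j
    exacts [hY.apply i j, hone i j, rfl, rfl, rfl, hone i j, hX.apply i j, rfl, rfl, rfl,
      rfl, rfl, (h22.smul (-d.α)).apply i j, rfl, rfl, rfl, rfl, rfl,
      (h33.smul (-d.α)).apply i j, rfl, rfl, rfl, rfl, rfl, (IsSymm.smul hΛi d.α).apply i j]
  rw [PiMatrix, IsSymm, fromBlocks_transpose, h11.eq, h2.eq, transpose_transpose]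

lemma posDef_PiMatrix_iff (hΦ : (noiseMatrix M b).IsSymm) (hQ : s.Q.IsSymm) (hΛ : Λ.IsSymm)
    (hRt : Rt.IsSymm) (hX : d.X.IsSymm) (hY : d.Y.IsSymm) :
    (PiMatrix M r b s As Bs Ξ Λ T Rt d).PosDef ↔
      ∀ x₁ x₂ w ρ b₁ b₂ c e, (x₁, x₂, w, ρ, b₁, b₂, c, e) ≠ 0 →
        0 < synthesisForm M r b s As Bs Ξ Λ T Rt d x₁ x₂ w ρ b₁ b₂ c e := by
  constructor
  · intro h x₁ x₂ w ρ b₁ b₂ c e hne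
    have hc : c = Sum.elim (c ∘ Sum.inl) (c ∘ Sum.inr) := by ext (i | i) <;> rfl
    rw [hc, ← PiMatrix_form hΦ hX]
    refine h.dotProduct_mulVec_pos fun h0 => hne ?_
    simp only [Prod.mk_eq_zero]
    refine ⟨funext fun i => congrFun h0 (.inl (.inl i)),
      funext fun i => congrFun h0 (.inl (.inr (.inl i))),
      funext fun i => congrFun h0 (.inl (.inr (.inr (.inl i)))),
      funext fun i => congrFun h0 (.inl (.inr (.inr (.inr i)))),
      funext fun i => congrFun h0 (.inr (.inl i)),
      funext fun i => congrFun h0 (.inr (.inr (.inl i))), ?_,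
      funext fun i => congrFun h0 (.inr (.inr (.inr (.inr (.inr i)))))⟩
    ext (i | i)
    · exact congrFun h0 (.inr (.inr (.inr (.inl i))))
    · exact congrFun h0 (.inr (.inr (.inr (.inr (.inl i)))))
  · intro h
    refine PosDef.of_dotProduct_mulVec_pos (PiMatrix_isSymm hΦ hQ hΛ hRt hX hY) fun x hx => ?_
    have hx' : x = Sum.elim (Sum.elim (fun i => x (.inl (.inl i)))
        (Sum.elim (fun i => x (.inl (.inr (.inl i))))
          (Sum.elim (fun i => x (.inl (.inr (.inr (.inl i)))))
            (fun i => x (.inl (.inr (.inr (.inr i)))))))) (Sum.elim (fun i => x (.inr (.inl i)))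
        (Sum.elim (fun i => x (.inr (.inr (.inl i))))
          (Sum.elim (fun i => x (.inr (.inr (.inr (.inl i)))))
            (Sum.elim (fun i => x (.inr (.inr (.inr (.inr (.inl i))))))
              (fun i => x (.inr (.inr (.inr (.inr (.inr i)))))))))) := by
      ext ((i | i | i | i) | (i | i | i | i | i)) <;> rfl
    rw [star_trivial, hx', PiMatrix_form hΦ hX]
    refine h _ _ _ _ _ _ _ _ fun h0 => hx ?_
    simp only [Prod.mk_eq_zero] at h0
    obtain ⟨h1, h2, h3, h4, h5, h6, h7, h8⟩ := h0
    ext ((i | i | i | i) | (i | i | i | i | i))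
    · exact congrFun h1 i
    · exact congrFun h2 i
    · exact congrFun h3 i
    · exact congrFun h4 i
    · exact congrFun h5 i
    · exact congrFun h6 i
    · exact congrFun h7 (.inl i)
    · exact congrFun h7 (.inr i)
    · exact congrFun h8 i

/-- The decision variables `d` arise from the controller `K` and the storage matrix
`(X, U; Uᵀ, X̂)` by the linearizing change of variables, where `Y` and `V` are the left blocks of
the inverse storage matrix, `Vt = Vᵀ`. -/
structure IsLinearization (M : KnownModel n m p q l) (As : Matrix (Fin n) (Fin n) ℝ)
    (Bs : Matrix (Fin n) (Fin m) ℝ) (d : Decision n m l) (K : Controller n m l)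
    (U Xh Vt : Matrix (Fin n) (Fin n) ℝ) : Prop where
  inv₁₁ : d.X * d.Y + U * Vt = 1
  inv₂₁ : Uᵀ * d.Y + Xh * Vt = 0
  At_eq : d.At = d.X * (As * d.Y + Bs * d.Ct) + U * K.Bc * M.C * d.Y + U * K.Ac * Vt
  Bt_eq : d.Bt = d.X * Bs * K.Dc + U * K.Bc
  Ct_eq : d.Ct = K.Dc * M.C * d.Y + K.Cc * Vt
  Dc_eq : d.Dc = K.Dc

variable {K : Controller n m l} {U Xh Vt : Matrix (Fin n) (Fin n) ℝ}

/-- The congruence transformation that linearizes the synthesis problem. -/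
lemma synthesisForm_eq (hX : d.X.IsSymm) (hd : IsLinearization M As Bs d K U Xh Vt)
    (x₁ x₂ : Fin n → ℝ) (w : Fin p → ℝ) (ρ : Fin qt → ℝ)
    (b₁ b₂ : Fin n → ℝ) (c : Fin n ⊕ Fin m → ℝ) (e : Fin nt → ℝ) :
    synthesisForm M r b s As Bs Ξ Λ T Rt d x₁ x₂ w ρ b₁ b₂ c e
      = robustForm (closedLoop M K As Bs) s T Rt (crossTerm M r b As Bs)
        (-(PhiT M r b).toBlocks₂₂) Ξ Λ (fromBlocks d.X U Uᵀ Xh) d.α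
        (Sum.elim (x₁ + d.Y *ᵥ x₂) (Vt *ᵥ x₂)) w ρ
        (Sum.elim (b₂ + d.Y *ᵥ b₁) (Vt *ᵥ b₁)) c e := by
  have hv₁ : ∀ v, d.X *ᵥ d.Y *ᵥ v + U *ᵥ Vt *ᵥ v = v := fun v => by
    rw [mulVec_mulVec, mulVec_mulVec, ← add_mulVec, hd.inv₁₁, one_mulVec]
  have hv₂ : ∀ v, Uᵀ *ᵥ d.Y *ᵥ v + Xh *ᵥ Vt *ᵥ v = 0 := fun v => by
    rw [mulVec_mulVec, mulVec_mulVec, ← add_mulVec, hd.inv₂₁, zero_mulVec]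
  have hP : ∀ u v, fromBlocks d.X U Uᵀ Xh *ᵥ Sum.elim (u + d.Y *ᵥ v) (Vt *ᵥ v)
      = Sum.elim (v + d.X *ᵥ u) (Uᵀ *ᵥ u) := by
    intro u v
    rw [fromBlocks_mulVec, Sum.elim_comp_inl, Sum.elim_comp_inr, mulVec_add, mulVec_add, add_assoc,
      add_assoc, hv₁, hv₂, add_zero, add_comm v]
  have hXd : ∀ u v, (d.X *ᵥ u) ⬝ᵥ v = u ⬝ᵥ d.X *ᵥ v := fun u v => by
    rw [dotProduct_comm, dotProduct_mulVec_comm_of_isSymm hX]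
  have hUd : ∀ u v, (Uᵀ *ᵥ u) ⬝ᵥ v = u ⬝ᵥ U *ᵥ v := fun u v => by
    rw [dotProduct_comm, dotProduct_transpose_mulVec_comm]
  have henergy : ∀ u v, Sum.elim (u + d.Y *ᵥ v) (Vt *ᵥ v) ⬝ᵥ Sum.elim (v + d.X *ᵥ u) (Uᵀ *ᵥ u)
      = v ⬝ᵥ d.Y *ᵥ v + 2 * (u ⬝ᵥ v) + u ⬝ᵥ d.X *ᵥ u := by
    intro u v
    have h1 := congrArg (u ⬝ᵥ ·) (hv₁ v)
    simp only [dotProduct_add] at h1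
    rw [dotProduct_comm, sumElim_dotProduct_sumElim, hUd]
    simp only [add_dotProduct, dotProduct_add, hXd]
    rw [dotProduct_comm v u]
    linarith
  have hJ : ∀ u v : Fin n → ℝ, (closedLoop M K As Bs).Jᵀ *ᵥ Sum.elim u v = u := fun u v => by
    simp only [closedLoop, transpose_fromRows, transpose_one, transpose_zero,
      fromCols_mulVec_sumElim, one_mulVec, zero_mulVec, add_zero]
  have hz : (closedLoop M K As Bs).C *ᵥ Sum.elim (x₁ + d.Y *ᵥ x₂) (Vt *ᵥ x₂)
      + (closedLoop M K As Bs).D *ᵥ w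
      = (M.C₁ + M.E * d.Dc * M.C) *ᵥ x₁ + (M.C₁ * d.Y + M.E * d.Ct) *ᵥ x₂
        + (M.D₁ + M.E * d.Dc * M.F) *ᵥ w := by
    simp only [closedLoop, clC, clD, fromCols_mulVec_sumElim, hd.Ct_eq, hd.Dc_eq, mulVec_add,
      add_mulVec, ← mulVec_mulVec]
    abel
  have hg : (closedLoop M K As Bs).G *ᵥ Sum.elim (x₁ + d.Y *ᵥ x₂) (Vt *ᵥ x₂)
      + (closedLoop M K As Bs).G' *ᵥ w
      = Sum.elim (x₁ + d.Y *ᵥ x₂)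
        ((d.Dc * M.C) *ᵥ x₁ + d.Ct *ᵥ x₂ + (d.Dc * M.F) *ᵥ w) := by
    have hsum : ∀ (f g : Fin n → ℝ) (f' g' : Fin m → ℝ),
        Sum.elim f f' + Sum.elim g g' = Sum.elim (f + g) (f' + g') := fun _ _ _ _ => by
      ext (i | i) <;> rfl
    simp only [closedLoop, fromBlocks_mulVec, Sum.elim_comp_inl, Sum.elim_comp_inr,
      fromRows_mulVec, hsum, hd.Ct_eq, hd.Dc_eq, mulVec_add, add_mulVec, ← mulVec_mulVec,
      one_mulVec, zero_mulVec, add_zero]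
    congr 1
    abel
  have hx : Sum.elim (b₁ + d.X *ᵥ b₂) (Uᵀ *ᵥ b₂) ⬝ᵥ
      ((closedLoop M K As Bs).A *ᵥ Sum.elim (x₁ + d.Y *ᵥ x₂) (Vt *ᵥ x₂)
        + (closedLoop M K As Bs).B *ᵥ w)
      = b₁ ⬝ᵥ ((As + Bs * d.Dc * M.C) *ᵥ x₁ + (As * d.Y + Bs * d.Ct) *ᵥ x₂
          + (M.B₁ + Bs * d.Dc * M.F) *ᵥ w)
        + b₂ ⬝ᵥ ((d.X * As + d.Bt * M.C) *ᵥ x₁ + d.At *ᵥ x₂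
          + (d.X * M.B₁ + d.Bt * M.F) *ᵥ w) := by
    simp only [closedLoop, clA, clB, fromBlocks_mulVec, Sum.elim_comp_inl, Sum.elim_comp_inr,
      fromRows_mulVec, sumElim_dotProduct_sumElim, dotProduct_add, hd.At_eq, hd.Bt_eq,
      hd.Ct_eq, hd.Dc_eq, mulVec_add, add_mulVec, ← mulVec_mulVec, add_dotProduct, hXd, hUd]
    ring
  rw [synthesisForm, robustForm, hP, hP, henergy, henergy, hJ, hz, hg, hx,
    dotProduct_comm x₁ x₂, dotProduct_comm b₁ b₂, dotProduct_comm x₂ x₁]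
  ring

lemma synthesisForm_pos_iff (hX : d.X.IsSymm) (hd : IsLinearization M As Bs d K U Xh Vt)
    (hVt : IsUnit Vt) :
    (∀ x₁ x₂ w ρ b₁ b₂ c e, (x₁, x₂, w, ρ, b₁, b₂, c, e) ≠ 0 →
        0 < synthesisForm M r b s As Bs Ξ Λ T Rt d x₁ x₂ w ρ b₁ b₂ c e) ↔
      ∀ ξ w ρ y c e, (ξ, w, ρ, y, c, e) ≠ 0 →
        0 < robustForm (closedLoop M K As Bs) s T Rt (crossTerm M r b As Bs)
          (-(PhiT M r b).toBlocks₂₂) Ξ Λ (fromBlocks d.X U Uᵀ Xh) d.α ξ w ρ y c e := by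
  have hinj : ∀ v, Vt *ᵥ v = 0 → v = 0 := fun v hv =>
    mulVec_injective_iff_isUnit.2 hVt (by rw [hv, mulVec_zero])
  have hsurj : ∀ ξ : Fin n ⊕ Fin n → ℝ, ∃ u v, Sum.elim (u + d.Y *ᵥ v) (Vt *ᵥ v) = ξ := by
    intro ξ
    obtain ⟨v, hv⟩ := mulVec_surjective_iff_isUnit.2 hVt (ξ ∘ Sum.inr)
    refine ⟨ξ ∘ Sum.inl - d.Y *ᵥ v, v, ?_⟩
    rw [sub_add_cancel, hv]
    ext (i | i) <;> rfl
  have hzero : ∀ u v, Sum.elim (u + d.Y *ᵥ v) (Vt *ᵥ v) = 0 → u = 0 ∧ v = 0 := by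
    intro u v h0
    have hv : v = 0 := hinj v (funext fun i => congrFun h0 (.inr i))
    refine ⟨?_, hv⟩
    rw [hv, mulVec_zero, mulVec_zero, add_zero] at h0
    exact funext fun i => congrFun h0 (.inl i)
  have hzero' : Sum.elim ((0 : Fin n → ℝ) + d.Y *ᵥ 0) (Vt *ᵥ 0) = 0 := by
    rw [mulVec_zero, mulVec_zero, add_zero]; ext (i | i) <;> rfl
  constructor
  · intro h ξ w ρ y c e hne
    obtain ⟨x₁, x₂, rfl⟩ := hsurj ξ
    obtain ⟨b₂, b₁, rfl⟩ := hsurj y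
    rw [← synthesisForm_eq hX hd]
    refine h _ _ _ _ _ _ _ _ fun h0 => hne ?_
    simp only [Prod.mk_eq_zero] at h0 ⊢
    obtain ⟨rfl, rfl, h3, h4, rfl, rfl, h7, h8⟩ := h0
    exact ⟨hzero', h3, h4, hzero', h7, h8⟩
  · intro h x₁ x₂ w ρ b₁ b₂ c e hne
    rw [synthesisForm_eq hX hd]
    refine h _ _ _ _ _ _ fun h0 => hne ?_
    simp only [Prod.mk_eq_zero] at h0 ⊢
    obtain ⟨h1, h2, h3, h4, h5, h6⟩ := h0
    obtain ⟨h7, h8⟩ := hzero _ _ h1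
    obtain ⟨h9, h10⟩ := hzero _ _ h4
    exact ⟨h7, h8, h2, h3, h10, h9, h5, h6⟩

end Synthesis

/-! ### From controllers to decision variables and back -/

section Main

variable {n m p q l N nt qt : ℕ} {M : KnownModel n m p q l} {r : Recording n m N}
  {b : NoiseBound p N} {s : Supply p q}
  {As : Matrix (Fin n) (Fin n) ℝ} {Bs : Matrix (Fin n) (Fin m) ℝ}
  {Ξ : Matrix (Fin n) (Fin nt) ℝ} {Λ : Matrix (Fin nt) (Fin nt) ℝ}
  {T : Matrix (Fin q) (Fin qt) ℝ} {Rt : Matrix (Fin qt) (Fin qt) ℝ}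

lemma isUnit_of_mulVec_eq_zero {k : Type*} [Fintype k] [DecidableEq k] {A : Matrix k k ℝ}
    (h : ∀ v, A *ᵥ v = 0 → v = 0) : IsUnit A := by
  refine mulVec_injective_iff_isUnit.1 fun u v huv => sub_eq_zero.1 (h _ ?_)
  rw [mulVec_sub, sub_eq_zero]
  exact huv

/-- A square matrix becomes invertible by adding an arbitrarily small multiple of the identity. -/
lemma exists_isUnit_add_smul_one {k : Type*} [Fintype k] [DecidableEq k] (A : Matrix k k ℝ)
    {ε : ℝ} (hε : 0 < ε) : ∃ t, |t| ≤ ε ∧ IsUnit (A + t • 1) := by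
  obtain ⟨t, ht, hroot⟩ := ((Set.Ioo_infinite hε).sdiff
    (-A).charpoly.roots.toFinset.finite_toSet).nonempty
  refine ⟨t, by rw [abs_of_pos ht.1]; exact ht.2.le, ?_⟩
  rw [isUnit_iff_isUnit_det, isUnit_iff_ne_zero]
  intro h0
  refine hroot ?_
  simp only [Finset.mem_coe, Multiset.mem_toFinset,
    Polynomial.mem_roots (charpoly_monic (-A)).ne_zero, Polynomial.IsRoot.def, eval_charpoly]
  rw [← h0, sub_neg_eq_add, add_comm A, scalar_apply, smul_one_eq_diagonal]

lemma isUnit_of_rank_eq {U : Matrix (Fin n) (Fin n) ℝ} (hU : U.rank = n) : IsUnit U := by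
  rw [← linearIndependent_rows_iff_isUnit, linearIndependent_iff_card_eq_finrank_span, Set.finrank,
    ← rank_eq_finrank_span_row, hU, Fintype.card_fin]

/-- From a storage matrix and a multiplier for a given controller to decision variables. The
storage matrix is first perturbed to make its off-diagonal block invertible. -/
lemma exists_isFeasible (hΦ : (noiseMatrix M b).IsSymm) (hQ : s.Q.IsSymm) (hΛ : Λ.PosDef)
    (hRt : Rt.PosDef) {K : Controller n m l} {P : Matrix (Fin n ⊕ Fin n) (Fin n ⊕ Fin n) ℝ}
    (hP : P.IsSymm) {α : ℝ}
    (hpos : ∀ ξ w ρ y c e, (ξ, w, ρ, y, c, e) ≠ 0 →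
      0 < robustForm (closedLoop M K As Bs) s T Rt (crossTerm M r b As Bs)
        (-(PhiT M r b).toBlocks₂₂) Ξ Λ P α ξ w ρ y c e) :
    ∃ d : Decision n m l, IsFeasible M r b s As Bs Ξ Λ T Rt d := by
  obtain ⟨ε, hε, hpert⟩ := exists_robustForm_perturb
    (fromBlocks 0 1 1 0 : Matrix (Fin n ⊕ Fin n) (Fin n ⊕ Fin n) ℝ) hpos
  obtain ⟨t, ht, hU⟩ := exists_isUnit_add_smul_one P.toBlocks₁₂ hε
  have hpos' := hpert t ht
  set X := P.toBlocks₁₁ with hX_def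
  set U := P.toBlocks₁₂ + t • (1 : Matrix (Fin n) (Fin n) ℝ) with hU_def
  set Xh := P.toBlocks₂₂
  have hX : X.IsSymm := ext fun i j => hP.apply _ _
  have hXh : Xh.IsSymm := ext fun i j => hP.apply _ _
  have hP21 : P.toBlocks₂₁ = P.toBlocks₁₂ᵀ := ext fun i j => hP.apply _ _
  have hPt : P + t • (fromBlocks 0 1 1 0 : Matrix (Fin n ⊕ Fin n) (Fin n ⊕ Fin n) ℝ)
      = fromBlocks X U Uᵀ Xh := by
    conv_lhs => rw [← fromBlocks_toBlocks P]
    rw [fromBlocks_smul, fromBlocks_add, hP21, hU_def, transpose_add, transpose_smul,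
      transpose_one, smul_zero, add_zero, add_zero]
  rw [hPt] at hpos'
  have hPs : (fromBlocks X U Uᵀ Xh).IsSymm := by
    rw [IsSymm, fromBlocks_transpose, hX.eq, hXh.eq, transpose_transpose]
  have hPd := posDef_of_robustForm_pos hPs hpos'
  have hinv := mul_nonsing_inv _ ((isUnit_iff_isUnit_det _).1 hPd.isUnit)
  set W := (fromBlocks X U Uᵀ Xh)⁻¹ with hW
  have hWs : W.IsSymm := by rw [IsSymm, hW, transpose_nonsing_inv, hPs.eq]
  set Y := W.toBlocks₁₁
  set Vt := W.toBlocks₂₁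
  have hY : Y.IsSymm := ext fun i j => hWs.apply _ _
  rw [← fromBlocks_toBlocks W, fromBlocks_multiply, ← fromBlocks_one, fromBlocks_inj] at hinv
  obtain ⟨h11, -, h21, -⟩ := hinv
  have hVt : IsUnit Vt := by
    refine isUnit_of_mulVec_eq_zero fun v hv => ?_
    have h1 : v = X *ᵥ Y *ᵥ v := by
      have := congrArg (· *ᵥ v) h11
      simp only [add_mulVec, ← mulVec_mulVec, one_mulVec] at this
      rw [hv, mulVec_zero, add_zero] at this
      exact this.symm
    have h2 : Uᵀ *ᵥ Y *ᵥ v = 0 := by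
      have := congrArg (· *ᵥ v) h21
      simp only [add_mulVec, ← mulVec_mulVec, zero_mulVec] at this
      rwa [hv, mulVec_zero, add_zero] at this
    have h3 : Y *ᵥ v = 0 :=
      mulVec_injective_iff_isUnit.2 ((isUnit_transpose U).2 hU) (by rw [h2, mulVec_zero])
    rw [h1, h3, mulVec_zero]
  let Ct := K.Dc * M.C * Y + K.Cc * Vt
  let d : Decision n m l :=
    { α := α
      X := X
      Y := Y
      At := X * (As * Y + Bs * Ct) + U * K.Bc * M.C * Y + U * K.Ac * Vt
      Bt := X * Bs * K.Dc + U * K.Bc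
      Ct := Ct
      Dc := K.Dc }
  have hd : IsLinearization M As Bs d K U Xh Vt := ⟨h11, h21, rfl, rfl, rfl, rfl⟩
  refine ⟨d, hX, hY, (posDef_PiMatrix_iff hΦ hQ hΛ.isHermitian hRt.isHermitian hX hY).2 ?_⟩
  exact (synthesisForm_pos_iff (d := d) hX hd hVt).2 hpos'

/-- The blocks `X, I, I, Y` alone force `I - X Y` to be invertible. -/
lemma isUnit_one_sub_mul {d : Decision n m l}
    (hpos : ∀ x₁ x₂ w ρ b₁ b₂ c e, (x₁, x₂, w, ρ, b₁, b₂, c, e) ≠ 0 →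
      0 < synthesisForm M r b s As Bs Ξ Λ T Rt d x₁ x₂ w ρ b₁ b₂ c e) :
    IsUnit (1 - d.X * d.Y) := by
  refine isUnit_of_mulVec_eq_zero fun v hv => ?_
  by_contra hne
  rw [sub_mulVec, one_mulVec, ← mulVec_mulVec, sub_eq_zero] at hv
  have h := hpos (-(d.Y *ᵥ v)) v 0 0 0 0 0 0 (by simp [hne])
  have h1 : (d.Y *ᵥ v) ⬝ᵥ v = v ⬝ᵥ d.Y *ᵥ v := dotProduct_comm _ _
  simp only [synthesisForm, slackSupply, multiplierForm, mulVec_zero, dotProduct_zero,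
    zero_dotProduct, mul_zero, add_zero, sub_zero, mulVec_neg, neg_dotProduct, dotProduct_neg,
    ← hv, h1] at h
  linarith

/-- The reconstructed controller is robustly dissipative, with storage matrix
`(X, U; Uᵀ, -Uᵀ Y V⁻ᵀ)`. -/
lemma isUnit_recV_and_exists_storage (hΦ : (noiseMatrix M b).IsSymm) (hQ : s.Q.IsSymm)
    (hΛ : Λ.PosDef) (hRt : Rt.PosDef) {d : Decision n m l}
    (hd : IsFeasible M r b s As Bs Ξ Λ T Rt d) {U : Matrix (Fin n) (Fin n) ℝ} (hU : IsUnit U) :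
    IsUnit (recV d U) ∧ ∃ P : Matrix (Fin n ⊕ Fin n) (Fin n ⊕ Fin n) ℝ, P.PosDef ∧ ∃ α : ℝ,
      ∀ ξ w ρ y c e, (ξ, w, ρ, y, c, e) ≠ 0 →
        0 < robustForm (closedLoop M (recController M As Bs d U) As Bs) s T Rt
          (crossTerm M r b As Bs) (-(PhiT M r b).toBlocks₂₂) Ξ Λ P α ξ w ρ y c e := by
  obtain ⟨hX, hY, hPi⟩ := hd
  have hΛs : Λ.IsSymm := hΛ.isHermitian
  have hRts : Rt.IsSymm := hRt.isHermitian
  have hpos := (posDef_PiMatrix_iff hΦ hQ hΛs hRts hX hY).1 hPi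
  have hU' := (isUnit_iff_isUnit_det _).1 hU
  have hVt : IsUnit (recV d U)ᵀ := by
    rw [recV, transpose_transpose]
    exact ((isUnit_nonsing_inv_iff).2 hU).mul (isUnit_one_sub_mul hpos)
  set Vt := (recV d U)ᵀ with hVt_def
  have hVt' := (isUnit_iff_isUnit_det _).1 hVt
  have hUV : U * Vt = 1 - d.X * d.Y := by
    rw [hVt_def, recV, transpose_transpose, mul_nonsing_inv_cancel_left _ _ hU']
  set Xh := -(Uᵀ * d.Y * Vt⁻¹) with hXh
  have hlin : IsLinearization M As Bs d (recController M As Bs d U) U Xh Vt := by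
    refine ⟨by rw [hUV]; abel, ?_, ?_, ?_, ?_, rfl⟩
    · rw [hXh, Matrix.neg_mul, nonsing_inv_mul_cancel_right _ _ hVt', add_neg_cancel]
    · simp only [recController, ← hVt_def]
      rw [mul_nonsing_inv_cancel_left _ _ hU', Matrix.mul_assoc U,
        nonsing_inv_mul_cancel_right _ _ hVt', mul_nonsing_inv_cancel_left _ _ hU']
      abel
    · simp only [recController]
      rw [mul_nonsing_inv_cancel_left _ _ hU']
      abel
    · simp only [recController, ← hVt_def]
      rw [nonsing_inv_mul_cancel_right _ _ hVt']
      abel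
  have hform := (synthesisForm_pos_iff hX hlin hVt).1 hpos
  have hXhs : Xh.IsSymm := by
    -- multiplication with `V` and `Vᵀ` turns `X̂` into the symmetric matrix `Y X Y - Y`
    have h1 : Vtᵀ * Xh * Vt = d.Y * d.X * d.Y - d.Y := by
      rw [hXh, Matrix.mul_neg, Matrix.neg_mul, ← Matrix.mul_assoc,
        nonsing_inv_mul_cancel_right _ _ hVt', ← Matrix.mul_assoc, ← transpose_mul, hUV,
        transpose_sub, transpose_one, transpose_mul, hX.eq, hY.eq, Matrix.sub_mul, Matrix.one_mul,
        neg_sub]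
    have h2 : Vtᵀ * Xhᵀ * Vt = Vtᵀ * Xh * Vt := by
      have h3 := congrArg transpose h1
      rw [transpose_mul, transpose_mul, transpose_transpose, transpose_sub, transpose_mul,
        transpose_mul, hX.eq, hY.eq, ← Matrix.mul_assoc, ← Matrix.mul_assoc, ← h1] at h3
      exact h3
    exact ((isUnit_transpose Vt).2 hVt).mul_left_cancel (hVt.mul_right_cancel h2)
  have hPs : (fromBlocks d.X U Uᵀ Xh).IsSymm := by
    rw [IsSymm, fromBlocks_transpose, hX.eq, hXhs.eq, transpose_transpose]
  exact ⟨(isUnit_transpose _).1 hVt, _, posDef_of_robustForm_pos hPs hform, _, hform⟩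

end Main

end DataDissipativity

open DataDissipativity
theorem theorem2 {n m p q l N nt qt : ℕ}
    (M : KnownModel n m p q l) (r : Recording n m N) (b : NoiseBound p N) (s : Supply p q)
    (hΦ : (noiseMatrix M b).IsSymm) (hΦ₂₂ : (-b.Φ₂₂).PosDef)
    (hrank : (r.Xminus ⬓ r.Uminus).rank = n + m)
    (hQ : s.Q.IsSymm) (hR : s.R.PosSemidef)
    (As : Matrix (Fin n) (Fin n) ℝ) (Bs : Matrix (Fin n) (Fin m) ℝ)
    (hs : (As, Bs) ∈ consistentSystems M r b)
    (Ξ : Matrix (Fin n) (Fin nt) ℝ) (Λ : Matrix (Fin nt) (Fin nt) ℝ) (hΛ : Λ.PosDef)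
    (hΞ : ((1 : Matrix (Fin n) (Fin n) ℝ) ◨ As ◨ Bs) * PhiT M r b
      * ((1 : Matrix (Fin n) (Fin n) ℝ) ◨ As ◨ Bs)ᵀ = Ξ * Λ * Ξᵀ)
    (T : Matrix (Fin q) (Fin qt) ℝ) (Rt : Matrix (Fin qt) (Fin qt) ℝ) (hRt : Rt.PosDef)
    (hT : s.R = T * Rt * Tᵀ) :
    ((∃ K : Controller n m l, RobustlyDissipative M r b s K) ↔
      ∃ d : Decision n m l, IsFeasible M r b s As Bs Ξ Λ T Rt d) ∧
    ∀ d : Decision n m l, IsFeasible M r b s As Bs Ξ Λ T Rt d →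
      ∀ U : Matrix (Fin n) (Fin n) ℝ, U.rank = n →
        IsUnit (recV d U) ∧ RobustlyDissipative M r b s (recController M As Bs d U) := by
  have hrec : ∀ d : Decision n m l, IsFeasible M r b s As Bs Ξ Λ T Rt d →
      ∀ U : Matrix (Fin n) (Fin n) ℝ, U.rank = n →
        IsUnit (recV d U) ∧ RobustlyDissipative M r b s (recController M As Bs d U) := by
    intro d hd U hU
    rw [robustlyDissipative_iff hΦ hΦ₂₂ hrank hQ hΛ hΞ hRt hT]
    exact isUnit_recV_and_exists_storage hΦ hQ hΛ hRt hd (isUnit_of_rank_eq hU)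
  refine ⟨⟨?_, ?_⟩, hrec⟩
  · rintro ⟨K, hK⟩
    obtain ⟨P, hP, α, hpos⟩ :=
      (robustlyDissipative_iff hΦ hΦ₂₂ hrank hQ hΛ hΞ hRt hT K).1 hK
    exact exists_isFeasible hΦ hQ hΛ hRt hP.isHermitian hpos
  · rintro ⟨d, hd⟩
    exact ⟨_, (hrec d hd 1 (by rw [rank_one, Fintype.card_fin])).2⟩
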